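/- Let $p\ge 2$ be an integer. There is a constant $C_0>0$ depending only on $p$ such that for every integer $s\ge 1$ and every explicit $S$-stage Runge–Kutta method of order $s$ with coefficients $(a_{ij})_{j<i}$, $(b_i)$ there is a constant $C>0$ depending only on $p$, $s$ and the method for which the following holds. Let $f:\mathbb R^d\to\mathbb R$ have a minimizer $x^*$, let $\mathcal A\subseteq\mathbb R^d$, $L>0$, $M\ge 0$, and assume: (growth) for all $x\in\mathcal A$ and $i=1,\dots,p-1$: $f(x)-f(x^*)\ge \frac1L\|\nabla^{(i)}f(x)\|^{p/(p-i)}$; (differentiability) $f$ is $\max\{p,s+2\}$ times continuously differentiable, and $\|\nabla^{(i)}f(x)\|\le M$ for all $x\in\mathcal A$ and all $i\in\{p,p+1,\dots,s\}\cup\{p\}\cup\{s+2\}$ with $i\ge p$ (operator norms of the derivatives as multilinear forms). Consider on $\mathbb R^{2d+1}$ the system $\dot y=F(y)$, where for $y=[v;x;t]$ $$F(y)=\Big[-\tfrac{2p+1}{t}v-p^2t^{p-2}\nabla f(x);\ v;\ 1\Big],$$ and put $$\mathcal E([v;x;t])=\frac{t^2}{4p^2}\|v\|^2+\Big\|x+\frac{t}{2p}v-x^*\Big\|^2+t^p\,(f(x)-f(x^*)).$$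 For a step size $h$ let $\varphi_h(y)$ be the exact solution of $\dot y=F(y)$ at time $h$ started at $y$ at time $0$, and let $\Phi_h(y)=y+h\sum_{i=1}^S b_iF(g_i)$ with $g_i=y+h\sum_{j<i}a_{ij}F(g_j)$ be one Runge–Kutta step. (The method has order $s$ if, for every smooth autonomous system on a finite-dimensional space and every initial point, the one-step error is $O(h^{s+1})$ as $h\to0^+$.) Let $\kappa=\max\{\max_i\sum_{j<i}|a_{ij}|,\ \sum_i|b_i|\}$. Let $y_c=[v_c;x_c;t_c]$ with $t_c\ge 1$, suppose the closed ball $B(x_c,1/t_c)$ is contained in $\mathcal A$, and write $E=\mathcal E(y_c)$. If $$0<h\le\min\Big\{0.2,\ \frac{1}{(1+\kappa)\,C_0\,(E+1)(L+M+1)}\Big\},$$ then the exact solution started at $y_c$ exists on $[0,h]$, and, for every such solution, $$\|\Phi_h(y_c)-\varphi_h(y_c)\|\le h^{s+1}\cdot\frac{C\big[(1+E)^{s+1}(L+M+1)^{s+1}+h\,(1+E)^{s+2}(L+M+1)^{s+2}\big]}{t_c}.$$ -/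

import Mathlib

noncomputable section

namespace RKAccel

open Set Filter Topology

/-! ### Explicit Runge--Kutta methods -/

/-- The coefficients of an explicit `S`-stage Runge--Kutta method. Only the entries `a i j` with
`j < i` are ever used. -/
structure RungeKutta (S : ℕ) where
  a : Fin S → Fin S → ℝ
  b : Fin S → ℝ

namespace RungeKutta

variable {S : ℕ} {V : Type*} [AddCommGroup V] [Module ℝ V]

/-- The stage `g_i = y + h ∑_{j < i} a_{ij} F(g_j)`. -/
def stage (rk : RungeKutta S) (F : V → V) (h : ℝ) (y : V) (i : Fin S) : V :=
  y + h • ∑ j : Fin i.val,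
    rk.a i ⟨j.val, j.isLt.trans i.isLt⟩ • F (stage rk F h y ⟨j.val, j.isLt.trans i.isLt⟩)
termination_by i.val
decreasing_by exact j.isLt

/-- One step `Φ_h(y) = y + h ∑_i b_i F(g_i)` of the method. -/
def step (rk : RungeKutta S) (F : V → V) (h : ℝ) (y : V) : V :=
  y + h • ∑ i : Fin S, rk.b i • F (rk.stage F h y i)

/-- `κ = max {max_i ∑_{j < i} |a_{ij}|, ∑_i |b_i|}`. -/
def kappa (rk : RungeKutta S) : ℝ :=
  max (⨆ i : Fin S, ∑ j : Fin i.val, |rk.a i ⟨j.val, j.isLt.trans i.isLt⟩|) (∑ i : Fin S, |rk.b i|)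

/-- The method has order (at least) `s`: for every smooth autonomous system `y' = F(y)` on a
finite-dimensional space and every initial value `y₀`, the one-step error satisfies
`‖Φ_h(y₀) - φ_h(y₀)‖ = O(h^{s+1})` as `h → 0⁺`, where `φ` is the local solution through `y₀`. -/
def HasOrder (rk : RungeKutta S) (s : ℕ) : Prop :=
  ∀ (W : Type) [NormedAddCommGroup W] [NormedSpace ℝ W] [FiniteDimensional ℝ W]
    (F : W → W), ContDiff ℝ (⊤ : ℕ∞) F →
    ∀ (y₀ : W) (φ : ℝ → W), φ 0 = y₀ → IsIntegralCurveAt φ (fun _ => F) 0 →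
      (fun h : ℝ => rk.step F h y₀ - φ h) =O[𝓝[>] 0] (fun h : ℝ => h ^ (s + 1))

end RungeKutta

/-! ### The dynamical system -/

/-- `ℝ^d` with its Euclidean norm. -/
abbrev Vec (d : ℕ) : Type := EuclideanSpace ℝ (Fin d)

/-- States `y = [v; x; t] ∈ ℝ^{2d+1}`, with the Euclidean norm
`‖y‖² = ‖v‖² + ‖x‖² + t²`. -/
abbrev State (d : ℕ) : Type := WithLp 2 (Vec d × WithLp 2 (Vec d × ℝ))

/-- The state `[v; x; t]`. -/
def mkState {d : ℕ} (v x : Vec d) (t : ℝ) : State d := WithLp.toLp 2 (v, WithLp.toLp 2 (x, t))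

/-- The component `v` of `[v; x; t]`. -/
def velocity {d : ℕ} (y : State d) : Vec d := y.fst

/-- The component `x` of `[v; x; t]`. -/
def position {d : ℕ} (y : State d) : Vec d := y.snd.fst

/-- The component `t` of `[v; x; t]`. -/
def time {d : ℕ} (y : State d) : ℝ := y.snd.snd

/-- The vector field
`F([v; x; t]) = [-((2p+1)/t) v - p² t^{p-2} ∇f(x); v; 1]` (used with `p ≥ 2`). -/
def field {d : ℕ} (p : ℕ) (f : Vec d → ℝ) (y : State d) : State d :=
  mkState
    (-(((2 * p + 1 : ℝ) / time y) • velocity y)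
      - ((p : ℝ) ^ 2 * time y ^ (p - 2)) • gradient f (position y))
    (velocity y) 1

/-- `φ` solves `φ' = F(φ)` on `[0, h]` with `φ(0) = y₀`. -/
def IsSolutionOn {V : Type*} [NormedAddCommGroup V] [NormedSpace ℝ V]
    (F : V → V) (y₀ : V) (h : ℝ) (φ : ℝ → V) : Prop :=
  φ 0 = y₀ ∧ IsIntegralCurveOn φ (fun _ => F) (Icc (0 : ℝ) h)

/-- The Lyapunov function
`𝓔([v; x; t]) = t²/(4p²) ‖v‖² + ‖x + t/(2p) v - x*‖² + t^p (f(x) - f(x*))`. -/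
def lyapunov {d : ℕ} (p : ℕ) (f : Vec d → ℝ) (xs : Vec d) (y : State d) : ℝ :=
  time y ^ 2 / (4 * (p : ℝ) ^ 2) * ‖velocity y‖ ^ 2
    + ‖position y + (time y / (2 * p)) • velocity y - xs‖ ^ 2
    + time y ^ p * (f (position y) - f xs)

/-! ### Assumptions on the objective -/

/-- Growth condition on `A`: `f(x) - f(x*) ≥ (1/L) ‖∇^{(i)} f(x)‖^{p/(p-i)}` for all `x ∈ A` and
`i = 1, …, p-1`. The norm is the operator norm of the derivative as a multilinear map. -/
def GrowthOn {d : ℕ} (p : ℕ) (L : ℝ) (f : Vec d → ℝ) (xs : Vec d) (A : Set (Vec d)) : Prop :=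
  ∀ x ∈ A, ∀ i : ℕ, 1 ≤ i → i < p →
    1 / L * ‖iteratedFDeriv ℝ i f x‖ ^ ((p : ℝ) / ((p : ℝ) - (i : ℝ))) ≤ f x - f xs

/-- Differentiability condition: `f` is continuously differentiable up to order `s + 2` (and at
least up to order `p`), and `‖∇^{(i)} f(x)‖ ≤ M` for all `x ∈ A` and `i = p, …, s` and `i = s + 2`
(the order `i = p` is always included, orders below `p` never are, and no bound on the order
`s + 1 > p` is needed). -/
def DifferentiableBoundedOn {d : ℕ} (p s : ℕ) (M : ℝ) (f : Vec d → ℝ) (A : Set (Vec d)) : Prop :=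
  ContDiff ℝ ((max p (s + 2) : ℕ) : WithTop ℕ∞) f ∧
    ∀ x ∈ A, ∀ i : ℕ, p ≤ i → (i = p ∨ i ≤ s ∨ i = s + 2) → ‖iteratedFDeriv ℝ i f x‖ ≤ M

end RKAccel

end

/-! The estimate is a dimensionless local error bound seen through a change of scale. Put c = t_c
and K = (E+1)(L+M+1). Write y = y_c + Tz, where T divides velocity and position by c and multiplies
time by c, and speed time up by K. By `field_conj` the system becomes z' = g(z) with g =
`scaledField`. On the ball of radius 1/2, the derivatives of g up to order s+1 are bounded in terms
of p and s alone. The energy bounds c v_c. Through the growth condition it also bounds the scaled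
derivatives of f of order below p at x_c. The mean value inequality carries these away from x_c, and
a Landau inequality supplies order s+1 from orders s and s+2 when s+1 > p.

The order hypothesis is qualitative and concerns smooth fields only, whereas g is merely C^{s+1} and
the constant must be uniform. `RungeKutta.HasOrder.exists_local_error_bound` bridges this. Replacing
g by its Taylor polynomial of degree s changes the numerical step and the exact solution by
O(h^{s+1}), so the error e(h) for g is O(h^{s+1}) too, with no control of the constant. But e is
C^{s+1} with explicit derivative bounds, and its Taylor polynomial of degree s has to vanish. The
Taylor remainder then gives a uniform constant.

Runge–Kutta steps and exact solutions both commute with the change of scale, so the error is T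
applied to a vector of size O((Kh)^{s+1}). The method and the flow both advance time by exactly h,
so this vector has no time component. On such vectors T is division by t_c, which yields the last
factor. -/

namespace RKAccel

open Set Filter Topology Asymptotics

/-! ### Calculus of uniform derivative bounds. -/

section DerivBound

variable {E F G : Type*} [NormedAddCommGroup E] [NormedSpace ℝ E] [NormedAddCommGroup F]
  [NormedSpace ℝ F] [NormedAddCommGroup G] [NormedSpace ℝ G]

/-- `f` is of class `C^n` on `s`, and its derivatives of order at most `n` within `s` are bounded
by `C`. -/
structure DerivBoundOn (n : ℕ) (C : ℝ) (f : E → F) (s : Set E) : Prop where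
  contDiffOn : ContDiffOn ℝ n f s
  bound : ∀ k ≤ n, ∀ x ∈ s, ‖iteratedFDerivWithin ℝ k f s x‖ ≤ C

namespace DerivBoundOn

variable {n : ℕ} {C C' : ℝ} {f f' : E → F} {s : Set E}

theorem mono (hf : DerivBoundOn n C f s) (h : C ≤ C') : DerivBoundOn n C' f s :=
  ⟨hf.contDiffOn, fun k hk x hx => (hf.bound k hk x hx).trans h⟩

theorem of_le {m : ℕ} (hf : DerivBoundOn n C f s) (h : m ≤ n) : DerivBoundOn m C f s :=
  ⟨hf.contDiffOn.of_le (by exact_mod_cast h), fun k hk x hx => hf.bound k (hk.trans h) x hx⟩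

theorem congr (hf : DerivBoundOn n C f s) (h : EqOn f' f s) : DerivBoundOn n C f' s :=
  ⟨hf.contDiffOn.congr h, fun k hk x hx => by
    rw [iteratedFDerivWithin_congr h hx]; exact hf.bound k hk x hx⟩

theorem contDiffWithinAt (hf : DerivBoundOn n C f s) {k : ℕ} (hk : k ≤ n) {x : E} (hx : x ∈ s) :
    ContDiffWithinAt ℝ k f s x :=
  (hf.contDiffOn x hx).of_le (by exact_mod_cast hk)

theorem norm_le (hf : DerivBoundOn n C f s) {x : E} (hx : x ∈ s) : ‖f x‖ ≤ C := by
  simpa using hf.bound 0 (Nat.zero_le _) x hx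

theorem const (c : F) : DerivBoundOn n ‖c‖ (fun _ : E => c) s := by
  refine ⟨contDiffOn_const, fun k _ x _ => ?_⟩
  rcases k with _ | k
  · simp
  · simp [iteratedFDerivWithin_succ_const]

theorem add (hs : UniqueDiffOn ℝ s) (hf : DerivBoundOn n C f s) (hf' : DerivBoundOn n C' f' s) :
    DerivBoundOn n (C + C') (fun x => f x + f' x) s := by
  refine ⟨hf.contDiffOn.add hf'.contDiffOn, fun k hk x hx => ?_⟩
  have := iteratedFDerivWithin_add_apply (hf.contDiffWithinAt hk hx) (hf'.contDiffWithinAt hk hx)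
    hs hx
  change ‖iteratedFDerivWithin ℝ k (f + f') s x‖ ≤ _
  rw [this]
  exact (norm_add_le _ _).trans (add_le_add (hf.bound k hk x hx) (hf'.bound k hk x hx))

theorem clm_comp (hs : UniqueDiffOn ℝ s) (T : F →L[ℝ] G) (hf : DerivBoundOn n C f s) :
    DerivBoundOn n (‖T‖ * C) (fun x => T (f x)) s := by
  refine ⟨T.contDiff.comp_contDiffOn hf.contDiffOn, fun k hk x hx => ?_⟩
  refine (T.norm_iteratedFDerivWithin_comp_left (hf.contDiffWithinAt hk hx) hs hx le_rfl).trans ?_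
  exact mul_le_mul_of_nonneg_left (hf.bound k hk x hx) (norm_nonneg _)

theorem const_smul (hs : UniqueDiffOn ℝ s) (a : ℝ) (hf : DerivBoundOn n C f s) :
    DerivBoundOn n (|a| * C) (fun x => a • f x) s := by
  refine ⟨contDiffOn_const.smul hf.contDiffOn, fun k hk x hx => ?_⟩
  have := iteratedFDerivWithin_const_smul_apply (a := a) (hf.contDiffWithinAt hk hx) hs hx
  change ‖iteratedFDerivWithin ℝ k (a • f) s x‖ ≤ _
  rw [this, norm_smul, Real.norm_eq_abs]
  exact mul_le_mul_of_nonneg_left (hf.bound k hk x hx) (abs_nonneg _)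

theorem neg (hs : UniqueDiffOn ℝ s) (hf : DerivBoundOn n C f s) :
    DerivBoundOn n C (fun x => -f x) s := by
  simpa using hf.const_smul hs (-1)

theorem sub (hs : UniqueDiffOn ℝ s) (hf : DerivBoundOn n C f s) (hf' : DerivBoundOn n C' f' s) :
    DerivBoundOn n (C + C') (fun x => f x - f' x) s := by
  simpa [sub_eq_add_neg] using hf.add hs (hf'.neg hs)

theorem sum {ι : Type*} (t : Finset ι) {c : ι → ℝ} {φ : ι → E → F} (hs : UniqueDiffOn ℝ s)
    (h : ∀ i ∈ t, DerivBoundOn n (c i) (φ i) s) :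
    DerivBoundOn n (∑ i ∈ t, c i) (fun x => ∑ i ∈ t, φ i x) s := by
  classical
  induction t using Finset.induction_on with
  | empty => simpa using (const (n := n) (s := s) (0 : F))
  | insert a t ha ih =>
    simp only [Finset.sum_insert ha]
    exact (h a (Finset.mem_insert_self _ _)).add hs
      (ih fun i hi => h i (Finset.mem_insert_of_mem hi))

theorem smul (hs : UniqueDiffOn ℝ s) {a : E → ℝ} (hC : 0 ≤ C) (hC' : 0 ≤ C')
    (ha : DerivBoundOn n C a s) (hf : DerivBoundOn n C' f s) :
    DerivBoundOn n (2 ^ n * (C * C')) (fun x => a x • f x) s := by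
  refine ⟨ha.contDiffOn.smul hf.contDiffOn, fun k hk x hx => ?_⟩
  refine (norm_iteratedFDerivWithin_smul_le ha.contDiffOn hf.contDiffOn hs hx
    (by exact_mod_cast hk)).trans ?_
  calc _ ≤ ∑ i ∈ Finset.range (k + 1), (k.choose i : ℝ) * (C * C') := by
        refine Finset.sum_le_sum fun i hi => ?_
        have hi' : i ≤ k := Nat.lt_succ_iff.1 (Finset.mem_range.1 hi)
        rw [mul_assoc]
        refine mul_le_mul_of_nonneg_left ?_ (by positivity)
        exact mul_le_mul (ha.bound i (hi'.trans hk) x hx)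
          (hf.bound _ ((Nat.sub_le _ _).trans hk) x hx) (norm_nonneg _) hC
    _ = 2 ^ k * (C * C') := by
        rw [← Finset.sum_mul]
        congr 1
        exact_mod_cast Nat.sum_range_choose k
    _ ≤ 2 ^ n * (C * C') := by
        gcongr
        norm_num

theorem comp {g : F → G} {t : Set F} {D : ℝ} (hs : UniqueDiffOn ℝ s) (ht : UniqueDiffOn ℝ t)
    (hg : DerivBoundOn n C g t) (hf : ContDiffOn ℝ n f s) (hst : MapsTo f s t) (hC : 0 ≤ C)
    (hD1 : 1 ≤ D)
    (hD : ∀ k, 1 ≤ k → k ≤ n → ∀ x ∈ s, ‖iteratedFDerivWithin ℝ k f s x‖ ≤ D) :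
    DerivBoundOn n (n.factorial * C * D ^ n) (fun x => g (f x)) s := by
  refine ⟨hg.contDiffOn.comp hf hst, fun k hk x hx => ?_⟩
  refine (norm_iteratedFDerivWithin_comp_le hg.contDiffOn hf (by exact_mod_cast hk) ht hs hst hx
    (C := C) (D := D) (fun i hi => hg.bound i (hi.trans hk) _ (hst hx)) fun i hi hik =>
      -- The Faà di Bruno estimate wants a bound by D ^ i in order i; since D ≥ 1 and i ≥ 1, the
      -- bound D suffices.
      (hD i hi (hik.trans hk) x hx).trans (le_self_pow₀ hD1 (by omega))).trans ?_
  gcongr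

end DerivBoundOn

/-- The first derivative is the constant T and the higher ones vanish. Order zero is excluded
because T itself may be unbounded on s. -/
theorem norm_iteratedFDerivWithin_clm_le {s : Set E} (hs : UniqueDiffOn ℝ s) (T : E →L[ℝ] F)
    {k : ℕ} (hk : 1 ≤ k) {x : E} (hx : x ∈ s) : ‖iteratedFDerivWithin ℝ k T s x‖ ≤ ‖T‖ := by
  obtain ⟨k, rfl⟩ : ∃ m, k = m + 1 := ⟨k - 1, by omega⟩
  rw [← norm_iteratedFDerivWithin_fderivWithin hs hx,
    iteratedFDerivWithin_congr (f := fun _ => T)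
      (fun y hy => T.fderivWithin (hs y hy)) hx]
  exact (DerivBoundOn.const (n := k) (s := s) T).bound k le_rfl x hx

theorem derivBoundOn_clm {s : Set E} (hs : UniqueDiffOn ℝ s) (T : E →L[ℝ] F) {n : ℕ} {C : ℝ}
    (hT : ‖T‖ ≤ C) (hC : ∀ x ∈ s, ‖T x‖ ≤ C) : DerivBoundOn n C T s := by
  refine ⟨T.contDiff.contDiffOn, fun k _ x hx => ?_⟩
  rcases Nat.eq_zero_or_pos k with rfl | hk
  · simpa using hC x hx
  · exact (norm_iteratedFDerivWithin_clm_le hs T hk hx).trans hT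

theorem DerivBoundOn.comp_clm {g : F → G} {t : Set F} {s : Set E} {n : ℕ} {C : ℝ}
    (hs : UniqueDiffOn ℝ s) (ht : UniqueDiffOn ℝ t) (hg : DerivBoundOn n C g t) (hC : 0 ≤ C)
    (T : E →L[ℝ] F) (hT : ‖T‖ ≤ 1) (hst : MapsTo T s t) :
    DerivBoundOn n (n.factorial * C) (fun x => g (T x)) s := by
  simpa using hg.comp hs ht T.contDiff.contDiffOn hst hC le_rfl fun k hk _ x hx =>
    (norm_iteratedFDerivWithin_clm_le hs T hk hx).trans hT

theorem exists_derivBoundOn_of_isCompact {s t : Set E} {f : E → F} {n : ℕ} (hs : IsOpen s)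
    (hst : s ⊆ t) (ht : IsCompact t) (htu : UniqueDiffOn ℝ t) (hf : ContDiffOn ℝ n f t) :
    ∃ C, 0 ≤ C ∧ DerivBoundOn n C f s := by
  have h : ∀ k ≤ n, ∃ C, ∀ x ∈ t, ‖iteratedFDerivWithin ℝ k f t x‖ ≤ C := fun k hk =>
    ht.exists_bound_of_continuousOn
      (hf.continuousOn_iteratedFDerivWithin (by exact_mod_cast hk) htu)
  choose! C hC using h
  refine ⟨∑ k ∈ Finset.range (n + 1), |C k|, Finset.sum_nonneg fun _ _ => abs_nonneg _,
    hf.mono hst, fun k hk x hx => ?_⟩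
  rw [iteratedFDerivWithin_subset hst hs.uniqueDiffOn htu
    (hf.of_le (by exact_mod_cast hk)) hx]
  exact ((hC k hk x (hst hx)).trans (le_abs_self _)).trans
    (Finset.single_le_sum (f := fun k => |C k|) (fun _ _ => abs_nonneg _)
      (Finset.mem_range.2 (by omega)))

end DerivBound

/-! ### Confinement and derivative bounds for stages, steps and solutions. -/

namespace RungeKutta

variable {S : ℕ} (rk : RungeKutta S)

theorem sum_abs_a_le_kappa (i : Fin S) :
    ∑ j : Fin i.val, |rk.a i ⟨j.val, j.isLt.trans i.isLt⟩| ≤ rk.kappa :=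
  (le_ciSup (f := fun i : Fin S => ∑ j : Fin i.val, |rk.a i ⟨j.val, j.isLt.trans i.isLt⟩|)
    (Set.finite_range _).bddAbove i).trans (le_max_left _ _)

theorem sum_abs_b_le_kappa : ∑ i : Fin S, |rk.b i| ≤ rk.kappa := le_max_right _ _

theorem kappa_nonneg : 0 ≤ rk.kappa :=
  (Finset.sum_nonneg fun _ _ => abs_nonneg _).trans rk.sum_abs_b_le_kappa

theorem stage_eq {V : Type*} [AddCommGroup V] [Module ℝ V] (F : V → V) (h : ℝ) (y : V)
    (i : Fin S) : rk.stage F h y i = y + h • ∑ j : Fin i.val,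
      rk.a i ⟨j.val, j.isLt.trans i.isLt⟩ •
        F (rk.stage F h y ⟨j.val, j.isLt.trans i.isLt⟩) := by
  rw [stage]

/-- Strong induction on the stages of a method. -/
theorem stage_induction {p : Fin S → Prop}
    (h : ∀ i : Fin S, (∀ j : Fin i.val, p ⟨j.val, j.isLt.trans i.isLt⟩) → p i) (i : Fin S) :
    p i := by
  obtain ⟨i, hi⟩ := i
  induction i using Nat.strong_induction_on with
  | _ i ih => exact h ⟨i, hi⟩ fun j => ih j.val j.isLt _

/-- A stage only evaluates g at earlier stages, which already lie in the ball where g is bounded, so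
the bound propagates by induction. -/
theorem norm_stage_le {V : Type*} [NormedAddCommGroup V] [NormedSpace ℝ V] {g : V → V}
    {ρ c₀ h : ℝ} (hg : ∀ z ∈ Metric.ball (0 : V) ρ, ‖g z‖ ≤ c₀) (h0 : 0 ≤ h) (hc : 0 ≤ c₀)
    (hρ : h * rk.kappa * c₀ < ρ) (i : Fin S) :
    ‖rk.stage g h 0 i‖ ≤ h * rk.kappa * c₀ := by
  induction i using stage_induction with
  | _ i ih =>
    rw [stage_eq, zero_add, norm_smul, Real.norm_of_nonneg h0, mul_assoc]
    refine mul_le_mul_of_nonneg_left ?_ h0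
    calc _ ≤ ∑ j : Fin i.val, |rk.a i ⟨j.val, j.isLt.trans i.isLt⟩| * c₀ := by
          refine norm_sum_le_of_le _ fun j _ => ?_
          rw [norm_smul, Real.norm_eq_abs]
          refine mul_le_mul_of_nonneg_left (hg _ ?_) (abs_nonneg _)
          rw [mem_ball_zero_iff]
          exact (ih j).trans_lt hρ
      _ ≤ _ := by
          rw [← Finset.sum_mul]
          exact mul_le_mul_of_nonneg_right (rk.sum_abs_a_le_kappa i) hc

end RungeKutta

theorem derivBoundOn_id_Icc {n : ℕ} {H : ℝ} (hH : 0 < H) (hH1 : H ≤ 1) :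
    DerivBoundOn n 1 (fun h : ℝ => h) (Icc 0 H) := by
  refine derivBoundOn_clm (uniqueDiffOn_Icc hH) (ContinuousLinearMap.id ℝ ℝ)
    ContinuousLinearMap.norm_id_le fun x hx => ?_
  simpa [abs_of_nonneg hx.1] using hx.2.trans hH1

/-- The curve `h ↦ h ∑ wᵢ g(γᵢ(h))` inherits derivative bounds from the curves `γᵢ`. -/
theorem DerivBoundOn.smul_sum_comp {V : Type*} [NormedAddCommGroup V] [NormedSpace ℝ V]
    {g : V → V} {U : Set V} {n : ℕ} {c B κ H : ℝ} {ι : Type*} [Fintype ι] {w : ι → ℝ}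
    {γ : ι → ℝ → V} (hc : 0 ≤ c) (hκ : 0 ≤ κ) (hw : ∑ i, |w i| ≤ κ) (hH : 0 < H) (hH1 : H ≤ 1)
    (hU : IsOpen U) (hg : DerivBoundOn n c g U) (hγU : ∀ i, MapsTo (γ i) (Icc 0 H) U)
    (hγ : ∀ i, DerivBoundOn n B (γ i) (Icc 0 H)) :
    DerivBoundOn n (2 ^ n * (1 * (κ * (n.factorial * c * (max 1 B) ^ n))))
      (fun h => h • ∑ i, w i • g (γ i h)) (Icc 0 H) := by
  have hu := uniqueDiffOn_Icc hH
  have hB : (0 : ℝ) ≤ n.factorial * c * (max 1 B) ^ n := by positivity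
  refine DerivBoundOn.smul hu zero_le_one (by positivity) (derivBoundOn_id_Icc hH hH1) ?_
  refine (DerivBoundOn.sum (c := fun i => |w i| * (n.factorial * c * (max 1 B) ^ n))
    Finset.univ hu fun i _ => ?_).mono ?_
  · refine DerivBoundOn.const_smul hu _ ?_
    exact hg.comp hu hU.uniqueDiffOn (hγ i).contDiffOn (hγU i) hc (le_max_left _ _)
      fun k _ hk x hx => ((hγ i).bound k hk x hx).trans (le_max_right _ _)
  · rw [← Finset.sum_mul]
    exact mul_le_mul_of_nonneg_right hw hB

/-- Each stage is built from compositions of g with earlier stages, so the chain rule bounds its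
derivatives in h. The order of quantifiers is the point: B is fixed before the space, the field and
the step range. -/
theorem RungeKutta.exists_stage_derivBoundOn {S : ℕ} (rk : RungeKutta S) (n : ℕ) {c : ℝ}
    (hc : 0 ≤ c) : ∃ B : ℝ, ∀ (V : Type) [NormedAddCommGroup V] [NormedSpace ℝ V] (g : V → V)
      (U : Set V) (H : ℝ), 0 < H → H ≤ 1 → IsOpen U → DerivBoundOn n c g U →
      (∀ h ∈ Icc (0 : ℝ) H, ∀ i, rk.stage g h 0 i ∈ U) →
      ∀ i, DerivBoundOn n B (fun h => rk.stage g h 0 i) (Icc 0 H) := by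
  -- The induction runs over the number m of stages treated, so that one B serves all of them and is
  -- chosen before V and g.
  suffices h : ∀ m : ℕ, ∃ B : ℝ, ∀ (V : Type) [NormedAddCommGroup V] [NormedSpace ℝ V] (g : V → V)
      (U : Set V) (H : ℝ), 0 < H → H ≤ 1 → IsOpen U → DerivBoundOn n c g U →
      (∀ h ∈ Icc (0 : ℝ) H, ∀ i, rk.stage g h 0 i ∈ U) →
      ∀ i : Fin S, i.val < m → DerivBoundOn n B (fun h => rk.stage g h 0 i) (Icc 0 H) by
    obtain ⟨B, hB⟩ := h S
    exact ⟨B, fun V _ _ g U H h1 h2 h3 h4 h5 i => hB V g U H h1 h2 h3 h4 h5 i i.isLt⟩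
  intro m
  induction m with
  | zero => exact ⟨0, fun V _ _ g U H _ _ _ _ _ i hi => absurd hi (Nat.not_lt_zero _)⟩
  | succ m ih =>
    obtain ⟨B, hB⟩ := ih
    refine ⟨max B (2 ^ n * (1 * (rk.kappa * (n.factorial * c * (max 1 B) ^ n)))), ?_⟩
    intro V _ _ g U H hH hH1 hU hg hst i hi
    rcases Nat.lt_succ_iff_lt_or_eq.1 hi with hi | hi
    · exact (hB V g U H hH hH1 hU hg hst i hi).mono (le_max_left _ _)
    · refine DerivBoundOn.mono ?_ (le_max_right _ _)
      have := DerivBoundOn.smul_sum_comp (ι := Fin i.val) hc rk.kappa_nonneg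
        (rk.sum_abs_a_le_kappa i) hH hH1 hU hg
        (γ := fun j h => rk.stage g h 0 ⟨j.val, j.isLt.trans i.isLt⟩) (B := B)
        (fun j h hh => hst h hh _)
        (fun j => hB V g U H hH hH1 hU hg hst _ (by have := j.isLt; simp only; omega))
      refine this.congr fun h _ => ?_
      simp only [rk.stage_eq g h 0 i, zero_add]

theorem RungeKutta.exists_step_derivBoundOn {S : ℕ} (rk : RungeKutta S) (n : ℕ) {c : ℝ}
    (hc : 0 ≤ c) : ∃ B : ℝ, ∀ (V : Type) [NormedAddCommGroup V] [NormedSpace ℝ V] (g : V → V)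
      (U : Set V) (H : ℝ), 0 < H → H ≤ 1 → IsOpen U → DerivBoundOn n c g U →
      (∀ h ∈ Icc (0 : ℝ) H, ∀ i, rk.stage g h 0 i ∈ U) →
      DerivBoundOn n B (fun h => rk.step g h 0) (Icc 0 H) := by
  obtain ⟨B, hB⟩ := rk.exists_stage_derivBoundOn n hc
  refine ⟨2 ^ n * (1 * (rk.kappa * (n.factorial * c * (max 1 B) ^ n))), ?_⟩
  intro V _ _ g U H hH hH1 hU hg hst
  have := DerivBoundOn.smul_sum_comp hc rk.kappa_nonneg rk.sum_abs_b_le_kappa hH hH1 hU hg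
    (γ := fun j h => rk.stage g h 0 j) (B := B) (fun j h hh => hst h hh _)
    (hB V g U H hH hH1 hU hg hst)
  refine this.congr fun h _ => ?_
  simp only [step, zero_add]

theorem derivBoundOn_succ_of_hasDerivWithinAt {V : Type*} [NormedAddCommGroup V] [NormedSpace ℝ V]
    {n : ℕ} {C : ℝ} {s : Set ℝ} {u v : ℝ → V} (hs : UniqueDiffOn ℝ s)
    (hu : ∀ t ∈ s, HasDerivWithinAt u (v t) s t) (hC : ∀ t ∈ s, ‖u t‖ ≤ C)
    (hv : DerivBoundOn n C v s) : DerivBoundOn (n + 1) C u s := by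
  have hd : EqOn (derivWithin u s) v s := fun t ht => (hu t ht).derivWithin (hs t ht)
  refine ⟨?_, fun k hk t ht => ?_⟩
  · push_cast
    rw [contDiffOn_succ_iff_derivWithin hs]
    refine ⟨fun t ht => (hu t ht).differentiableWithinAt, by simp, hv.contDiffOn.congr hd⟩
  · rcases k with _ | k
    · simpa using hC t ht
    · rw [norm_iteratedFDerivWithin_eq_norm_iteratedDerivWithin, iteratedDerivWithin_succ',
        ← norm_iteratedFDerivWithin_eq_norm_iteratedDerivWithin,
        iteratedFDerivWithin_congr hd ht]
      exact hv.bound k (by omega) t ht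

/-- A barrier argument: whenever ‖ψ t‖ touches c₀ t the solution is still inside the ball, where its
speed is strictly below c₀. The strict bound on g removes any need to know in advance that ψ stays
in the ball. -/
theorem IsSolutionOn.norm_le {V : Type*} [NormedAddCommGroup V] [NormedSpace ℝ V] {g : V → V}
    {ρ c₀ H : ℝ} {ψ : ℝ → V} (hψ : IsSolutionOn g 0 H ψ)
    (hg : ∀ z ∈ Metric.ball (0 : V) ρ, ‖g z‖ < c₀) (hc : 0 ≤ c₀) (hH : H * c₀ < ρ) {t : ℝ}
    (ht : t ∈ Icc 0 H) : ‖ψ t‖ ≤ c₀ * t := by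
  refine image_norm_le_of_norm_deriv_right_lt_deriv_boundary (f := ψ) (f' := fun t => g (ψ t))
    (B := fun t => c₀ * t) (B' := fun _ => c₀)
    (fun x hx => (hψ.2 x hx).continuousWithinAt)
    (fun x hx => ((hψ.2 x ⟨hx.1, hx.2.le⟩).mono_of_mem_nhdsWithin (Icc_mem_nhdsGE_of_mem hx)))
    (by simp [hψ.1]) (fun x => by simpa using (hasDerivAt_id x).const_mul c₀) ?_ ht
  intro x hx he
  refine hg _ ?_
  rw [mem_ball_zero_iff, he]
  refine lt_of_le_of_lt ?_ hH
  rw [mul_comm]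
  exact mul_le_mul_of_nonneg_right hx.2.le hc

/-- Bootstrapping in ψ' = g ∘ ψ: bounds for m derivatives of ψ bound m derivatives of ψ', hence m +
1 derivatives of ψ. -/
theorem exists_solution_derivBoundOn (n : ℕ) {c : ℝ} (hc : 0 ≤ c) :
    ∃ B : ℝ, ∀ (V : Type) [NormedAddCommGroup V] [NormedSpace ℝ V] (g : V → V)
      (U : Set V) (H : ℝ) (ψ : ℝ → V), 0 < H → H ≤ 1 → IsOpen U → DerivBoundOn n c g U →
      IsSolutionOn g 0 H ψ → MapsTo ψ (Icc 0 H) U → DerivBoundOn n B ψ (Icc 0 H) := by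
  have key : ∀ m ≤ n, ∃ B : ℝ, ∀ (V : Type) [NormedAddCommGroup V] [NormedSpace ℝ V] (g : V → V)
      (U : Set V) (H : ℝ) (ψ : ℝ → V), 0 < H → H ≤ 1 → IsOpen U → DerivBoundOn n c g U →
      IsSolutionOn g 0 H ψ → MapsTo ψ (Icc 0 H) U → DerivBoundOn m B ψ (Icc 0 H) := by
    have h0 : ∀ (V : Type) [NormedAddCommGroup V] [NormedSpace ℝ V] (g : V → V)
      (U : Set V) (H : ℝ) (ψ : ℝ → V), 0 < H → H ≤ 1 → DerivBoundOn n c g U →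
      IsSolutionOn g 0 H ψ → MapsTo ψ (Icc 0 H) U → ∀ t ∈ Icc 0 H, ‖ψ t‖ ≤ c := by
      intro V _ _ g U H ψ hH hH1 hg hψ hU t ht
      have := (convex_Icc (0 : ℝ) H).norm_image_sub_le_of_norm_hasDerivWithin_le
        (f := ψ) (f' := fun t => g (ψ t)) (C := c) hψ.2 (fun x hx => hg.norm_le (hU hx))
        (left_mem_Icc.2 hH.le) ht
      rw [hψ.1, sub_zero, sub_zero, Real.norm_of_nonneg ht.1] at this
      exact this.trans (mul_le_of_le_one_right hc (ht.2.trans hH1))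
    intro m
    induction m with
    | zero =>
      refine fun _ => ⟨c, fun V _ _ g U H ψ hH hH1 hU hg hψ hψU => ⟨?_, ?_⟩⟩
      · exact contDiffOn_zero.2 fun x hx => (hψ.2 x hx).continuousWithinAt
      · intro k hk t ht
        obtain rfl : k = 0 := by omega
        simpa using h0 V g U H ψ hH hH1 hg hψ hψU t ht
    | succ m ih =>
      intro hm
      obtain ⟨B, hB⟩ := ih (by omega)
      refine ⟨max c (m.factorial * c * (max 1 B) ^ m), ?_⟩
      intro V _ _ g U H ψ hH hH1 hU hg hψ hψU
      have hB' := hB V g U H ψ hH hH1 hU hg hψ hψU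
      have hu := uniqueDiffOn_Icc hH
      refine derivBoundOn_succ_of_hasDerivWithinAt hu hψ.2
        (fun t ht => (h0 V g U H ψ hH hH1 hg hψ hψU t ht).trans (le_max_left _ _)) ?_
      refine DerivBoundOn.mono ?_ (le_max_right _ _)
      exact (hg.of_le (by omega)).comp hu hU.uniqueDiffOn hB'.contDiffOn hψU hc (le_max_left _ _)
        fun k _ hk x hx => (hB'.bound k hk x hx).trans (le_max_right _ _)
  exact key n le_rfl

/-! ### Taylor polynomials and remainders. -/

section Taylor

variable {E F : Type*} [NormedAddCommGroup E] [NormedSpace ℝ E] [NormedAddCommGroup F]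
  [NormedSpace ℝ F]

/-- The Taylor polynomial of `g` of degree `n` at the origin. -/
noncomputable def taylorPoly (g : E → F) (n : ℕ) (w : E) : F :=
  ∑ k ∈ Finset.range (n + 1), ((k.factorial : ℝ)⁻¹) • iteratedFDeriv ℝ k g 0 fun _ => w

theorem contDiff_taylorPoly (g : E → F) (n : ℕ) {m : WithTop ℕ∞} :
    ContDiff ℝ m (taylorPoly g n) := by
  unfold taylorPoly
  refine ContDiff.sum fun k _ => contDiff_const.smul ?_
  exact (iteratedFDeriv ℝ k g 0).contDiff.comp (contDiff_pi.2 fun _ => contDiff_id)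

theorem DerivBoundOn.norm_sub_taylorPoly_le {g : E → F} {n : ℕ} {c ρ : ℝ}
    (hg : DerivBoundOn (n + 1) c g (Metric.ball 0 ρ)) {w : E} (hw : w ∈ Metric.ball (0 : E) ρ) :
    ‖g w - taylorPoly g n w‖ ≤ c * ‖w‖ ^ (n + 1) / n.factorial := by
  -- Restriction to the segment τ ↦ τ w reduces the claim to the one-variable Taylor theorem on [0,
  -- 1].
  set T : ℝ →L[ℝ] E := (ContinuousLinearMap.id ℝ ℝ).smulRight w with hT
  have hTa : ∀ τ, T τ = τ • w := fun τ => by simp [hT]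
  have hball : IsOpen (Metric.ball (0 : E) ρ) := Metric.isOpen_ball
  have hJ : IsOpen (T ⁻¹' Metric.ball (0 : E) ρ) := hball.preimage T.continuous
  have hI : Icc (0 : ℝ) 1 ⊆ T ⁻¹' Metric.ball (0 : E) ρ := by
    intro τ hτ
    rw [mem_preimage, hTa, mem_ball_zero_iff, norm_smul, Real.norm_of_nonneg hτ.1]
    exact (mul_le_of_le_one_left (norm_nonneg _) hτ.2).trans_lt (mem_ball_zero_iff.1 hw)
  have hu := uniqueDiffOn_Icc (zero_lt_one' ℝ)
  have hcomp : ContDiffOn ℝ (n + 1 : ℕ) (g ∘ T) (T ⁻¹' Metric.ball (0 : E) ρ) :=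
    hg.contDiffOn.comp T.contDiff.contDiffOn (mapsTo_preimage _ _)
  have hder : ∀ k ≤ n + 1, ∀ τ ∈ Icc (0 : ℝ) 1,
      iteratedDerivWithin k (g ∘ T) (Icc 0 1) τ = iteratedFDeriv ℝ k g (τ • w) fun _ => w := by
    intro k hk τ hτ
    have hk' : ((k : ℕ) : WithTop ℕ∞) ≤ ((n + 1 : ℕ) : WithTop ℕ∞) := by exact_mod_cast hk
    rw [iteratedDerivWithin_eq_iteratedFDerivWithin,
      iteratedFDerivWithin_subset hI hu hJ.uniqueDiffOn (hcomp.of_le hk') hτ,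
      T.iteratedFDerivWithin_comp_right (hg.contDiffOn.of_le hk') hball.uniqueDiffOn
        hJ.uniqueDiffOn (hI hτ) le_rfl, iteratedFDerivWithin_of_isOpen k hball (hI hτ), hTa]
    simp [hTa]
  have h1 : ‖(g ∘ T) 1 - taylorWithinEval (g ∘ T) n (Icc 0 1) 0 1‖ ≤
      (c * ‖w‖ ^ (n + 1)) * (1 - 0) ^ (n + 1) / n.factorial := by
    refine taylor_mean_remainder_bound zero_le_one ?_ (right_mem_Icc.2 zero_le_one) ?_
    · exact_mod_cast hcomp.mono hI
    · intro τ hτ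
      rw [hder _ le_rfl τ hτ]
      refine (ContinuousMultilinearMap.le_opNorm _ _).trans ?_
      rw [Finset.prod_const, Finset.card_univ, Fintype.card_fin]
      refine mul_le_mul_of_nonneg_right ?_ (by positivity)
      have := hg.bound _ le_rfl (τ • w) (by simpa [hTa] using hI hτ)
      rwa [iteratedFDerivWithin_of_isOpen _ hball (by simpa [hTa] using hI hτ)] at this
  rw [taylor_within_apply] at h1
  have h2 : ∑ k ∈ Finset.range (n + 1), ((k.factorial : ℝ)⁻¹ * (1 - 0) ^ k) •
      iteratedDerivWithin k (g ∘ T) (Icc 0 1) 0 = taylorPoly g n w := by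
    refine Finset.sum_congr rfl fun k hk => ?_
    rw [hder k (Finset.mem_range.1 hk).le 0 (left_mem_Icc.2 zero_le_one)]
    simp
  rw [h2] at h1
  simpa [hTa] using h1

/-- Letting t → 0 kills the constant coefficient; dividing by t lowers the degree and the order
together. -/
theorem eq_zero_of_sum_pow_smul_isBigO {n : ℕ} {a : ℕ → F}
    (h : (fun t : ℝ => ∑ k ∈ Finset.range (n + 1), t ^ k • a k) =O[𝓝[>] 0]
      fun t : ℝ => t ^ (n + 1)) : ∀ k ≤ n, a k = 0 := by
  induction n generalizing a with
  | zero =>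
    intro k hk
    obtain rfl : k = 0 := by omega
    simp only [zero_add, Finset.range_one, Finset.sum_singleton, pow_zero, one_smul, pow_one] at h
    have h0 : Tendsto (fun t : ℝ => t) (𝓝[>] 0) (𝓝 0) := tendsto_nhdsWithin_of_tendsto_nhds tendsto_id
    exact tendsto_nhds_unique tendsto_const_nhds (h.trans_tendsto h0)
  | succ n ih =>
    have ha : a 0 = 0 := by
      have h1 : Tendsto (fun t : ℝ => ∑ k ∈ Finset.range (n + 1 + 1), t ^ k • a k) (𝓝[>] 0)
          (𝓝 (∑ k ∈ Finset.range (n + 1 + 1), (0 : ℝ) ^ k • a k)) := by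
        refine tendsto_nhdsWithin_of_tendsto_nhds (Continuous.tendsto ?_ 0)
        fun_prop
      have h0 : Tendsto (fun t : ℝ => t ^ (n + 1 + 1)) (𝓝[>] 0) (𝓝 0) := by
        refine tendsto_nhdsWithin_of_tendsto_nhds ?_
        have : Continuous fun t : ℝ => t ^ (n + 1 + 1) := by fun_prop
        simpa using this.tendsto 0
      have h2 := tendsto_nhds_unique h1 (h.trans_tendsto h0)
      rw [Finset.sum_range_succ'] at h2
      simpa using h2
    have h3 : (fun t : ℝ => ∑ k ∈ Finset.range (n + 1), t ^ k • a (k + 1)) =O[𝓝[>] 0]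
        fun t : ℝ => t ^ (n + 1) := by
      have h4 := (isBigO_refl (fun t : ℝ => t⁻¹) (𝓝[>] 0)).smul h
      refine (h4.congr' ?_ ?_)
      · filter_upwards [self_mem_nhdsWithin] with t ht
        have ht' : t ≠ 0 := ne_of_gt ht
        rw [Finset.sum_range_succ', ha, smul_zero, add_zero, Finset.smul_sum]
        refine Finset.sum_congr rfl fun k _ => ?_
        rw [smul_smul, pow_succ', inv_mul_cancel_left₀ ht']
      · filter_upwards [self_mem_nhdsWithin] with t ht
        have ht' : t ≠ 0 := ne_of_gt ht
        rw [smul_eq_mul, pow_succ' t (n + 1), inv_mul_cancel_left₀ ht']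
    intro k hk
    rcases k with _ | k
    · exact ha
    · exact ih h3 k (by omega)

/-- This turns an asymptotic statement with uncontrolled constant and range into an explicit bound
at H: the asymptotics force the Taylor polynomial at 0 to vanish, and B controls what remains. -/
theorem DerivBoundOn.norm_le_of_isBigO {n : ℕ} {B H : ℝ} {e : ℝ → F} (hH : 0 < H)
    (he : DerivBoundOn (n + 1) B e (Icc 0 H))
    (h : e =O[𝓝[>] 0] fun t : ℝ => t ^ (n + 1)) : ‖e H‖ ≤ B * H ^ (n + 1) / n.factorial := by
  have hR : ∀ t ∈ Icc 0 H, ‖e t - taylorWithinEval e n (Icc 0 H) 0 t‖ ≤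
      B * (t - 0) ^ (n + 1) / n.factorial := fun t ht => by
    refine taylor_mean_remainder_bound hH.le (by exact_mod_cast he.contDiffOn) ht fun y hy => ?_
    rw [← norm_iteratedFDerivWithin_eq_norm_iteratedDerivWithin]
    exact he.bound _ le_rfl y hy
  set a : ℕ → F := fun k => (k.factorial : ℝ)⁻¹ • iteratedDerivWithin k e (Icc 0 H) 0 with ha
  have hT : ∀ t, taylorWithinEval e n (Icc 0 H) 0 t =
      ∑ k ∈ Finset.range (n + 1), t ^ k • a k := fun t => by
    rw [taylor_within_apply]
    refine Finset.sum_congr rfl fun k _ => ?_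
    rw [ha, smul_smul, sub_zero, mul_comm]
  have hO : (fun t : ℝ => ∑ k ∈ Finset.range (n + 1), t ^ k • a k) =O[𝓝[>] 0]
      fun t : ℝ => t ^ (n + 1) := by
    have h1 : (fun t => e t - taylorWithinEval e n (Icc 0 H) 0 t) =O[𝓝[>] 0]
        fun t : ℝ => t ^ (n + 1) := by
      refine IsBigO.of_bound (B / n.factorial) ?_
      filter_upwards [Ioc_mem_nhdsGT hH] with t ht
      refine (hR t ⟨ht.1.le, ht.2⟩).trans (le_of_eq ?_)
      rw [Real.norm_of_nonneg (pow_nonneg ht.1.le _), sub_zero]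
      ring
    refine (h.sub h1).congr_left fun t => ?_
    rw [sub_sub_cancel, hT]
  have h0 := eq_zero_of_sum_pow_smul_isBigO hO
  have := hR H (right_mem_Icc.2 hH.le)
  rwa [hT, Finset.sum_eq_zero fun k hk => by
    rw [h0 k (Nat.lt_succ_iff.1 (Finset.mem_range.1 hk)), smul_zero], sub_zero, sub_zero] at this

end Taylor

/-! ### Effect of replacing a field by one that agrees to order m at the origin. -/

section Comparison

variable {V : Type*} [NormedAddCommGroup V] [NormedSpace ℝ V]

theorem RungeKutta.stage_isBigO {S : ℕ} (rk : RungeKutta S) {g : V → V} (hg : ContinuousAt g 0)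
    (i : Fin S) : (fun h => rk.stage g h 0 i) =O[𝓝[>] 0] fun h : ℝ => h := by
  induction i using RungeKutta.stage_induction with
  | _ i ih =>
    have hid : Tendsto (fun h : ℝ => h) (𝓝[>] 0) (𝓝 0) :=
      tendsto_nhdsWithin_of_tendsto_nhds tendsto_id
    have h1 : (fun h : ℝ => h • ∑ j : Fin i.val, rk.a i ⟨j.val, j.isLt.trans i.isLt⟩ •
        g (rk.stage g h 0 ⟨j.val, j.isLt.trans i.isLt⟩)) =O[𝓝[>] 0] fun h : ℝ => h • (1 : ℝ) := by
      refine (isBigO_refl _ _).smul (IsBigO.fun_sum fun j _ => ?_)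
      exact (((hg.tendsto.comp ((ih j).trans_tendsto hid)).isBigO_one ℝ)).const_smul_left _
    simpa [rk.stage_eq g _ 0 i] using h1

/-- With x and X the stages for g and P, split g(x) - P(X) as (g - P)(x) plus P(x) - P(X). The first
part is small because x = O(h), the second because P is locally Lipschitz and x - X involves only
earlier stages. -/
theorem RungeKutta.field_stage_sub_isBigO {S : ℕ} (rk : RungeKutta S) {g P : V → V} {m : ℕ}
    (hg : ContinuousAt g 0) (hP : ContDiffAt ℝ 1 P 0)
    (hgP : (fun z => g z - P z) =O[𝓝 0] fun z => ‖z‖ ^ m) (i : Fin S) :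
    (fun h => g (rk.stage g h 0 i) - P (rk.stage P h 0 i)) =O[𝓝[>] 0] fun h : ℝ => h ^ m := by
  have hid : Tendsto (fun h : ℝ => h) (𝓝[>] 0) (𝓝 0) :=
    tendsto_nhdsWithin_of_tendsto_nhds tendsto_id
  obtain ⟨K, t, ht, hK⟩ := hP.exists_lipschitzOnWith
  induction i using RungeKutta.stage_induction with
  | _ i ih =>
    have hx := rk.stage_isBigO hg i
    have hX := rk.stage_isBigO hP.continuousAt i
    have hx0 := hx.trans_tendsto hid
    have hX0 := hX.trans_tendsto hid
    have h1 : (fun h => g (rk.stage g h 0 i) - P (rk.stage g h 0 i)) =O[𝓝[>] 0]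
        fun h : ℝ => h ^ m := (hgP.comp_tendsto hx0).trans (hx.norm_left.pow m)
    have h2 : (fun h => P (rk.stage g h 0 i) - P (rk.stage P h 0 i)) =O[𝓝[>] 0]
        fun h => rk.stage g h 0 i - rk.stage P h 0 i := by
      refine IsBigO.of_bound K ?_
      filter_upwards [hx0.eventually ht, hX0.eventually ht] with h a b
      exact hK.norm_sub_le a b
    have h3 : (fun h => rk.stage g h 0 i - rk.stage P h 0 i) =O[𝓝[>] 0]
        fun h : ℝ => h ^ m := by
      have h4 : (fun h : ℝ => h • ∑ j : Fin i.val, rk.a i ⟨j.val, j.isLt.trans i.isLt⟩ •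
          (g (rk.stage g h 0 ⟨j.val, j.isLt.trans i.isLt⟩) -
            P (rk.stage P h 0 ⟨j.val, j.isLt.trans i.isLt⟩))) =O[𝓝[>] 0]
          fun h : ℝ => (1 : ℝ) • h ^ m :=
        -- The prefactor h would gain one more order, but boundedness is enough here.
        (hid.isBigO_one ℝ).smul (IsBigO.fun_sum fun j _ => (ih j).const_smul_left _)
      simp only [one_smul] at h4
      refine h4.congr_left fun h => ?_
      rw [rk.stage_eq g h 0 i, rk.stage_eq P h 0 i]
      simp only [smul_sub, Finset.sum_sub_distrib, zero_add]
    simpa using h1.add (h2.trans h3)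

theorem RungeKutta.step_sub_isBigO {S : ℕ} (rk : RungeKutta S) {g P : V → V} {m : ℕ}
    (hg : ContinuousAt g 0) (hP : ContDiffAt ℝ 1 P 0)
    (hgP : (fun z => g z - P z) =O[𝓝 0] fun z => ‖z‖ ^ m) :
    (fun h => rk.step g h 0 - rk.step P h 0) =O[𝓝[>] 0] fun h : ℝ => h ^ m := by
  have hid : Tendsto (fun h : ℝ => h) (𝓝[>] 0) (𝓝 0) :=
    tendsto_nhdsWithin_of_tendsto_nhds tendsto_id
  have h4 : (fun h : ℝ => h • ∑ j : Fin S, rk.b j •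
      (g (rk.stage g h 0 j) - P (rk.stage P h 0 j))) =O[𝓝[>] 0] fun h : ℝ => (1 : ℝ) • h ^ m :=
    (hid.isBigO_one ℝ).smul (IsBigO.fun_sum fun j _ =>
      (rk.field_stage_sub_isBigO hg hP hgP j).const_smul_left _)
  simp only [one_smul] at h4
  refine h4.congr_left fun h => ?_
  simp only [step, smul_sub, Finset.sum_sub_distrib, zero_add]

theorem gronwallBound_zero_eq_mul (K ε x : ℝ) :
    gronwallBound 0 K ε x = ε * gronwallBound 0 K 1 x := by
  unfold gronwallBound
  split_ifs <;> ring

/-- Grönwall's inequality: ψ solves the P-equation up to a defect ‖g(ψ) - P(ψ)‖, which is O(h^m) on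
[0, h] since ψ grows at most linearly. -/
theorem solution_sub_isBigO {g P : V → V} {m : ℕ} {H c₁ : ℝ} {ψ φ : ℝ → V} (hH : 0 < H)
    (hc : 0 ≤ c₁) (hP : ContDiffAt ℝ 1 P 0)
    (hgP : (fun z => g z - P z) =O[𝓝 0] fun z => ‖z‖ ^ m)
    (hψ : IsSolutionOn g 0 H ψ) (hψb : ∀ t ∈ Icc 0 H, ‖ψ t‖ ≤ c₁ * t)
    (hφ0 : φ 0 = 0) (hφ : IsIntegralCurveAt φ (fun _ => P) 0) :
    (fun h => ψ h - φ h) =O[𝓝[>] 0] fun h : ℝ => h ^ m := by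
  obtain ⟨K, t, ht, hK⟩ := hP.exists_lipschitzOnWith
  obtain ⟨A, hA0, hA⟩ := hgP.exists_nonneg
  have hψ0 : Tendsto ψ (𝓝[≥] 0) (𝓝 0) := by
    have := (hψ.2 0 (left_mem_Icc.2 hH.le)).continuousWithinAt
    rw [ContinuousWithinAt, hψ.1] at this
    rwa [nhdsWithin_Icc_eq_nhdsGE hH] at this
  have hφt : Tendsto φ (𝓝[≥] 0) (𝓝 0) := by
    have := (hφ.self_of_nhds).continuousAt.tendsto
    rw [hφ0] at this
    exact tendsto_nhdsWithin_of_tendsto_nhds this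
  have hall : ∀ᶠ τ in 𝓝[≥] (0 : ℝ), ψ τ ∈ t ∧ φ τ ∈ t ∧ ‖g (ψ τ) - P (ψ τ)‖ ≤ A * ‖‖ψ τ‖ ^ m‖ ∧
      HasDerivAt φ (P (φ τ)) τ ∧ τ < H := by
    filter_upwards [hψ0.eventually ht, hφt.eventually ht, hψ0.eventually hA.bound,
      hφ.filter_mono nhdsWithin_le_nhds,
      (eventually_lt_nhds hH).filter_mono nhdsWithin_le_nhds] with τ a b c d e
    exact ⟨a, b, c, d, e⟩
  obtain ⟨δ, hδ, hδs⟩ := mem_nhdsGE_iff_exists_Ico_subset.1 hall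
  have hδ : (0 : ℝ) < δ := hδ
  refine IsBigO.of_bound (A * c₁ ^ m * gronwallBound 0 K 1 δ) ?_
  filter_upwards [Ioo_mem_nhdsGT hδ] with h hh
  have hsub : ∀ τ ∈ Icc 0 h, τ ∈ Ico 0 δ := fun τ hτ => ⟨hτ.1, hτ.2.trans_lt hh.2⟩
  have hHτ : ∀ τ ∈ Icc 0 h, τ ∈ Ico 0 H := fun τ hτ => ⟨hτ.1, (hδs (hsub τ hτ)).2.2.2.2⟩
  have key := dist_le_of_approx_trajectories_ODE_of_mem (v := fun _ => P) (s := fun _ => t)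
    (f := ψ) (f' := fun τ => g (ψ τ)) (g := φ) (g' := fun τ => P (φ τ)) (a := 0) (b := h)
    (εf := A * (c₁ * h) ^ m) (εg := 0) (δ := 0) (K := K) (fun _ _ => hK)
    (fun τ hτ => ((hψ.2 τ (Ico_subset_Icc_self (hHτ τ hτ))).continuousWithinAt).mono
      fun x hx => Ico_subset_Icc_self (hHτ x hx))
    (fun τ hτ => (hψ.2 τ (Ico_subset_Icc_self (hHτ τ (Ico_subset_Icc_self hτ)))).mono_of_mem_nhdsWithin
      (Icc_mem_nhdsGE_of_mem (hHτ τ (Ico_subset_Icc_self hτ))))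
    (fun τ hτ => by
      have hτ' := Ico_subset_Icc_self hτ
      rw [dist_eq_norm]
      refine (hδs (hsub τ hτ')).2.2.1.trans ?_
      rw [norm_pow, norm_norm]
      have := (hψb τ (Ico_subset_Icc_self (hHτ τ hτ'))).trans
        (mul_le_mul_of_nonneg_left hτ'.2 hc)
      gcongr)
    (fun τ hτ => (hδs (hsub τ (Ico_subset_Icc_self hτ))).1)
    (fun τ hτ => (hδs (hsub τ hτ)).2.2.2.1.continuousAt.continuousWithinAt)
    (fun τ hτ => (hδs (hsub τ (Ico_subset_Icc_self hτ))).2.2.2.1.hasDerivWithinAt)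
    (fun τ hτ => by simp)
    (fun τ hτ => (hδs (hsub τ (Ico_subset_Icc_self hτ))).2.1)
    (by simp [hψ.1, hφ0]) h (right_mem_Icc.2 hh.1.le)
  rw [dist_eq_norm, add_zero, sub_zero, gronwallBound_zero_eq_mul] at key
  refine key.trans ?_
  rw [Real.norm_of_nonneg (pow_nonneg hh.1.le _), mul_pow]
  have hmono : gronwallBound 0 K 1 h ≤ gronwallBound 0 K 1 δ :=
    gronwallBound_mono le_rfl zero_le_one K.2 hh.2.le
  calc _ ≤ A * (c₁ ^ m * h ^ m) * gronwallBound 0 K 1 δ := by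
        refine mul_le_mul_of_nonneg_left hmono ?_
        have := hh.1.le
        positivity
    _ = _ := by ring

end Comparison

/-! ### Uniform local error, and existence of solutions. -/

/-- The uniform local error estimate for a method of order `s` applied to a field whose
derivatives up to order `s + 1` are bounded by `c` near the initial point. -/
theorem RungeKutta.HasOrder.exists_local_error_bound {S s : ℕ} {rk : RungeKutta S}
    (ho : rk.HasOrder s) {c : ℝ} (hc : 0 ≤ c) :
    ∃ C : ℝ, 0 < C ∧ ∀ (V : Type) [NormedAddCommGroup V] [NormedSpace ℝ V]
      [FiniteDimensional ℝ V] (g : V → V) (ρ c₀ H : ℝ) (ψ : ℝ → V), 0 < H → H ≤ 1 → 0 ≤ c₀ →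
      DerivBoundOn (s + 1) c g (Metric.ball 0 ρ) → (∀ z ∈ Metric.ball (0 : V) ρ, ‖g z‖ < c₀) →
      H * (1 + rk.kappa) * c₀ < ρ → IsSolutionOn g 0 H ψ →
      ‖rk.step g H 0 - ψ H‖ ≤ C * H ^ (s + 1) := by
  obtain ⟨B₁, hB₁⟩ := rk.exists_step_derivBoundOn (s + 1) hc
  obtain ⟨B₂, hB₂⟩ := exists_solution_derivBoundOn (s + 1) hc
  refine ⟨max 1 ((B₁ + B₂) / s.factorial), lt_max_of_lt_left one_pos, ?_⟩
  intro V _ _ _ g ρ c₀ H ψ hH hH1 hc₀ hg hgc hρ hψ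
  have hκ := rk.kappa_nonneg
  have hHκ : 0 ≤ H * rk.kappa * c₀ := by positivity
  have hHc : 0 ≤ H * c₀ := by positivity
  have hρ' : H * rk.kappa * c₀ + H * c₀ < ρ := by nlinarith
  have hρ0 : 0 < ρ := by linarith
  have hψb : ∀ t ∈ Icc 0 H, ‖ψ t‖ ≤ c₀ * t := fun t ht => hψ.norm_le hgc hc₀ (by linarith) ht
  have hψU : MapsTo ψ (Icc 0 H) (Metric.ball 0 ρ) := fun t ht => by
    rw [mem_ball_zero_iff]
    have := mul_le_mul_of_nonneg_left ht.2 hc₀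
    linarith [hψb t ht]
  have hst : ∀ h ∈ Icc (0 : ℝ) H, ∀ i, rk.stage g h 0 i ∈ Metric.ball (0 : V) ρ := by
    intro h hh i
    have h1 : h * rk.kappa * c₀ ≤ H * rk.kappa * c₀ := by
      have := hh.2
      gcongr
    rw [mem_ball_zero_iff]
    have := rk.norm_stage_le (fun z hz => (hgc z hz).le) hh.1 hc₀ (by linarith) i
    linarith
  have he := (hB₁ V g _ H hH hH1 Metric.isOpen_ball hg hst).sub (uniqueDiffOn_Icc hH)
    (hB₂ V g _ H ψ hH hH1 Metric.isOpen_ball hg hψ hψU)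
  -- The Taylor polynomial is smooth although g is only C^{s+1}, so the order hypothesis applies to
  -- it.
  have hP : ContDiff ℝ (⊤ : ℕ∞) (taylorPoly g s) := contDiff_taylorPoly g s
  have hP1 : ContDiffAt ℝ 1 (taylorPoly g s) 0 := (contDiff_taylorPoly g s).contDiffAt
  have hball : Metric.ball (0 : V) ρ ∈ 𝓝 0 := Metric.ball_mem_nhds _ hρ0
  have hgP : (fun z => g z - taylorPoly g s z) =O[𝓝 0] fun z => ‖z‖ ^ (s + 1) := by
    refine IsBigO.of_bound (c / s.factorial) ?_
    filter_upwards [hball] with z hz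
    refine (hg.norm_sub_taylorPoly_le hz).trans (le_of_eq ?_)
    rw [Real.norm_of_nonneg (by positivity)]
    ring
  obtain ⟨φ, hφ0, ε, hε, hφ⟩ :=
    hP1.exists_forall_mem_closedBall_exists_eq_forall_mem_Ioo_hasDerivAt₀ 0
  have hφc : IsIntegralCurveAt φ (fun _ => taylorPoly g s) 0 := by
    filter_upwards [Ioo_mem_nhds (show (0 : ℝ) - ε < 0 by linarith)
      (show (0 : ℝ) < 0 + ε by linarith)] with t ht using hφ t ht
  have hO : (fun h => rk.step g h 0 - ψ h) =O[𝓝[>] 0] fun h : ℝ => h ^ (s + 1) := by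
    have h1 := rk.step_sub_isBigO (hg.contDiffOn.continuousOn.continuousAt hball) hP1 hgP
    have h2 := ho V (taylorPoly g s) hP 0 φ hφ0 hφc
    have h3 := solution_sub_isBigO hH hc₀ hP1 hgP hψ hψb hφ0 hφc
    -- The error for g is the change of the step, plus the error for the polynomial field, minus the
    -- change of the solution.
    refine ((h1.add h2).sub h3).congr_left fun h => ?_
    abel
  refine (he.norm_le_of_isBigO hH hO).trans ?_
  rw [mul_div_right_comm]
  exact mul_le_mul_of_nonneg_right (le_max_right _ _) (by positivity)

theorem exists_isSolutionOn {V : Type*} [NormedAddCommGroup V] [NormedSpace ℝ V] [CompleteSpace V]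
    {g : V → V} {ρ c c₀ H : ℝ} {n : ℕ} (hH : 0 < H) (hc₀ : 0 ≤ c₀)
    (hg : DerivBoundOn (n + 1) c g (Metric.ball 0 ρ))
    (hgc : ∀ z ∈ Metric.ball (0 : V) ρ, ‖g z‖ < c₀) (hρ : H * c₀ < ρ) :
    ∃ ψ, IsSolutionOn g 0 H ψ := by
  have hsub : Metric.closedBall (0 : V) (H * c₀) ⊆ Metric.ball 0 ρ :=
    Metric.closedBall_subset_ball hρ
  have hρ0 : 0 < ρ := lt_of_le_of_lt (by positivity) hρ
  have hc : 0 ≤ c := (norm_nonneg _).trans (hg.norm_le (Metric.mem_ball_self hρ0))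
  have hlip : LipschitzOnWith c.toNNReal g (Metric.ball 0 ρ) := by
    refine (convex_ball (0 : V) ρ).lipschitzOnWith_of_nnnorm_fderivWithin_le
      (𝕜 := ℝ) (hg.contDiffOn.differentiableOn (by simp)) fun x hx => ?_
    rw [← NNReal.coe_le_coe, coe_nnnorm, Real.coe_toNNReal _ hc]
    have := hg.bound 1 (by omega) x hx
    rwa [← norm_iteratedFDerivWithin_fderivWithin Metric.isOpen_ball.uniqueDiffOn hx,
      norm_iteratedFDerivWithin_zero] at this
  have hpl : IsPicardLindelof (fun _ => g) (tmin := 0) (tmax := H)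
      ⟨0, left_mem_Icc.2 hH.le⟩ 0 (H * c₀).toNNReal 0 c₀.toNNReal c.toNNReal := by
    refine IsPicardLindelof.of_time_independent (fun x hx => ?_) (hlip.mono ?_) ?_
    · rw [Real.coe_toNNReal _ hc₀]
      rw [Real.coe_toNNReal _ (by positivity)] at hx
      exact (hgc x (hsub hx)).le
    · rw [Real.coe_toNNReal _ (by positivity)]
      exact hsub
    · rw [Real.coe_toNNReal _ hc₀, Real.coe_toNNReal _ (by positivity)]
      simp [max_eq_left hH.le, mul_comm]
  obtain ⟨ψ, h0, h⟩ := hpl.exists_eq_forall_mem_Icc_hasDerivWithinAt₀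
  exact ⟨ψ, h0, h⟩

/-! ### Equivariance under affine changes of variable and rescaling of time. -/

section Conjugation

variable {V : Type*} [NormedAddCommGroup V] [NormedSpace ℝ V] {F g : V → V} {y₀ : V}
  {T : V ≃L[ℝ] V} {K : ℝ}

/-- Stages are affine combinations of field values, so T passes through them, and the factor K of
the field is absorbed by the step size. -/
theorem RungeKutta.stage_conj {S : ℕ} (rk : RungeKutta S)
    (hF : ∀ z, F (y₀ + T z) = K • T (g z)) (h : ℝ) (i : Fin S) :
    rk.stage F h y₀ i = y₀ + T (rk.stage g (K * h) 0 i) := by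
  induction i using RungeKutta.stage_induction with
  | _ i ih =>
    rw [rk.stage_eq F, rk.stage_eq g, zero_add, map_smul, map_sum, mul_comm K h, mul_smul,
      Finset.smul_sum (r := K)]
    congr 2
    refine Finset.sum_congr rfl fun j _ => ?_
    rw [ih j, hF, map_smul, smul_comm, mul_comm]

theorem RungeKutta.step_conj {S : ℕ} (rk : RungeKutta S)
    (hF : ∀ z, F (y₀ + T z) = K • T (g z)) (h : ℝ) :
    rk.step F h y₀ = y₀ + T (rk.step g (K * h) 0) := by
  rw [step, step, zero_add, map_smul, map_sum, mul_comm K h, mul_smul, Finset.smul_sum (r := K)]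
  congr 2
  refine Finset.sum_congr rfl fun j _ => ?_
  rw [rk.stage_conj hF, hF, map_smul, smul_comm, mul_comm]

theorem IsSolutionOn.of_conj {h : ℝ} {ψ : ℝ → V} (hF : ∀ z, F (y₀ + T z) = K • T (g z))
    (hK : 0 < K) (hψ : IsSolutionOn g 0 (K * h) ψ) :
    IsSolutionOn F y₀ h fun t => y₀ + T (ψ (K * t)) := by
  refine ⟨by simp [hψ.1], fun t ht => ?_⟩
  have hm : MapsTo (fun t => K * t) (Icc 0 h) (Icc 0 (K * h)) := fun t ht =>
    ⟨mul_nonneg hK.le ht.1, mul_le_mul_of_nonneg_left ht.2 hK.le⟩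
  have h1 := (hψ.2 (K * t) (hm ht)).scomp t (h := fun t => K * t) (h' := K)
    (by simpa using ((hasDerivAt_id t).const_mul K).hasDerivWithinAt) hm
  have h2 := (T : V →L[ℝ] V).hasFDerivAt.comp_hasDerivWithinAt t h1
  have h3 := h2.const_add y₀
  simp only [hF]
  simpa using h3

theorem IsSolutionOn.conj {h : ℝ} {φ : ℝ → V} (hF : ∀ z, F (y₀ + T z) = K • T (g z))
    (hK : 0 < K) (hφ : IsSolutionOn F y₀ h φ) :
    IsSolutionOn g 0 (K * h) fun τ => T.symm (φ (K⁻¹ * τ) - y₀) := by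
  refine ⟨by simp [hφ.1], fun τ hτ => ?_⟩
  have hm : MapsTo (fun τ => K⁻¹ * τ) (Icc 0 (K * h)) (Icc 0 h) := fun t ht =>
    ⟨mul_nonneg (inv_nonneg.2 hK.le) ht.1, by
      have := mul_le_mul_of_nonneg_left ht.2 (inv_nonneg.2 hK.le)
      rwa [inv_mul_cancel_left₀ hK.ne'] at this⟩
  have h1 := (hφ.2 (K⁻¹ * τ) (hm hτ)).scomp τ (h := fun t => K⁻¹ * t) (h' := K⁻¹)
    (by simpa using ((hasDerivAt_id τ).const_mul K⁻¹).hasDerivWithinAt) hm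
  have h2 := (T.symm : V →L[ℝ] V).hasFDerivAt.comp_hasDerivWithinAt τ (h1.sub_const y₀)
  have h4 : g (T.symm (φ (K⁻¹ * τ) - y₀)) = T.symm (K⁻¹ • F (φ (K⁻¹ * τ))) := by
    have := hF (T.symm (φ (K⁻¹ * τ) - y₀))
    rw [T.apply_symm_apply, add_sub_cancel] at this
    rw [this, smul_smul, inv_mul_cancel₀ hK.ne', one_smul, T.symm_apply_apply]
  simp only [h4]
  exact h2

/-- The uniform local error estimate in conjugated coordinates. -/
theorem RungeKutta.HasOrder.exists_local_error_bound_conj {S s : ℕ} {rk : RungeKutta S}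
    (ho : rk.HasOrder s) {c : ℝ} (hc : 0 ≤ c) :
    ∃ C : ℝ, 0 < C ∧ ∀ (V : Type) [NormedAddCommGroup V] [NormedSpace ℝ V]
      [FiniteDimensional ℝ V] (F g : V → V) (y₀ : V) (T : V ≃L[ℝ] V) (K ρ c₀ h : ℝ) (φ : ℝ → V),
      (∀ z, F (y₀ + T z) = K • T (g z)) → 0 < K → 0 < h → K * h ≤ 1 → 0 ≤ c₀ →
      DerivBoundOn (s + 1) c g (Metric.ball 0 ρ) → (∀ z ∈ Metric.ball (0 : V) ρ, ‖g z‖ < c₀) →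
      K * h * (1 + rk.kappa) * c₀ < ρ → IsSolutionOn F y₀ h φ →
      ∃ z, rk.step F h y₀ - φ h = T z ∧ ‖z‖ ≤ C * (K * h) ^ (s + 1) := by
  obtain ⟨C, hC, herr⟩ := ho.exists_local_error_bound hc
  refine ⟨C, hC, fun V _ _ _ F g y₀ T K ρ c₀ h φ hF hK hh hKh hc₀ hg hgc hρ hφ => ?_⟩
  have hb := herr V g ρ c₀ (K * h) _ (mul_pos hK hh) hKh hc₀ hg hgc hρ (hφ.conj hF hK)
  rw [inv_mul_cancel_left₀ hK.ne'] at hb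
  refine ⟨_, ?_, hb⟩
  rw [rk.step_conj hF, map_sub, ContinuousLinearEquiv.apply_symm_apply]
  abel

end Conjugation

/-! ### Intermediate derivatives from neighbouring ones. -/

section Interpolation

variable {E G : Type*} [NormedAddCommGroup E] [NormedSpace ℝ E] [NormedAddCommGroup G]
  [NormedSpace ℝ G]

/-- A Landau-type inequality: on the half ball the first derivative is controlled by the function
and its second derivative on the unit ball. -/
theorem norm_fderiv_le_of_norm_le_of_norm_fderiv_fderiv_le {f : E → G} {a b : ℝ}
    (hf : Differentiable ℝ f) (hf' : Differentiable ℝ (fderiv ℝ f))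
    (ha : ∀ x ∈ Metric.ball (0 : E) 1, ‖f x‖ ≤ a)
    (hb : ∀ x ∈ Metric.ball (0 : E) 1, ‖fderiv ℝ (fderiv ℝ f) x‖ ≤ b) {x : E}
    (hx : x ∈ Metric.ball (0 : E) (1 / 2)) : ‖fderiv ℝ f x‖ ≤ 4 * a + b / 2 := by
  rw [mem_ball_zero_iff] at hx
  have hx1 : x ∈ Metric.ball (0 : E) 1 := by rw [mem_ball_zero_iff]; linarith
  have ha0 : 0 ≤ a := (norm_nonneg _).trans (ha x hx1)
  have hb0 : 0 ≤ b := (norm_nonneg (fderiv ℝ (fderiv ℝ f) x)).trans (hb x hx1)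
  have hball : Metric.ball x (1 / 2) ⊆ Metric.ball (0 : E) 1 := by
    refine Metric.ball_subset_ball' ?_
    rw [dist_zero_right]; linarith
  refine ContinuousLinearMap.opNorm_le_of_unit_norm (by positivity) fun u hu => ?_
  refine le_of_forall_pos_le_add fun η hη => ?_
  -- The difference quotient of step ε costs 2a/ε, best at ε = 1/2; the ball is open, so that value
  -- is only approached and the loss η is removed at the end.
  obtain ⟨ε, hε0, hε, hεη⟩ : ∃ ε : ℝ, 0 < ε ∧ ε < 1 / 2 ∧ 2 * a / ε ≤ 4 * a + η := by
    have hc : Tendsto (fun ε : ℝ => 2 * a / ε) (𝓝[<] (1 / 2)) (𝓝 (2 * a / (1 / 2))) := by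
      refine tendsto_nhdsWithin_of_tendsto_nhds ?_
      exact (tendsto_const_nhds.div tendsto_id (by norm_num))
    have h1 := hc.eventually (ge_mem_nhds (show 2 * a / (1 / 2) < 4 * a + η by linarith))
    have h2 : Ioo (0 : ℝ) (1 / 2) ∈ 𝓝[<] (1 / 2 : ℝ) := Ioo_mem_nhdsLT (by norm_num)
    obtain ⟨ε, hε1, hε2⟩ := (h1.and h2).exists
    exact ⟨ε, hε2.1, hε2.2, hε1⟩
  have hxu : x + ε • u ∈ Metric.ball x (1 / 2) := by
    rw [mem_ball_iff_norm, add_sub_cancel_left, norm_smul, hu, mul_one,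
      Real.norm_of_nonneg hε0.le]
    exact hε
  have hxx : x ∈ Metric.ball x (1 / 2) := Metric.mem_ball_self (by norm_num)
  have hD : ∀ y ∈ Metric.ball x (1 / 2), ‖fderiv ℝ f y - fderiv ℝ f x‖ ≤ b / 2 := by
    intro y hy
    refine ((convex_ball x (1 / 2)).norm_image_sub_le_of_norm_fderiv_le
      (fun z _ => hf' z) (fun z hz => hb z (hball hz)) hxx hy).trans ?_
    have := (mem_ball_iff_norm.1 hy).le
    have := mul_le_mul_of_nonneg_left this hb0
    linarith
  have h3 := (convex_ball x (1 / 2)).norm_image_sub_le_of_norm_fderiv_le'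
    (fun z _ => hf z) hD hxx hxu
  rw [add_sub_cancel_left, norm_smul, hu, mul_one, Real.norm_of_nonneg hε0.le, map_smul] at h3
  have h4 : ‖ε • fderiv ℝ f x u‖ ≤ 2 * a + b / 2 * ε := by
    have e : ε • fderiv ℝ f x u = f (x + ε • u) - f x - (f (x + ε • u) - f x - ε • fderiv ℝ f x u) := by
      abel
    rw [e]
    refine (norm_sub_le _ _).trans (add_le_add ((norm_sub_le _ _).trans ?_) h3)
    linarith [ha _ (hball hxu), ha _ hx1]
  rw [norm_smul, Real.norm_of_nonneg hε0.le] at h4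
  have h5 : ‖fderiv ℝ f x u‖ ≤ (2 * a + b / 2 * ε) / ε := by
    rw [le_div_iff₀ hε0]; linarith
  rw [add_div, mul_div_cancel_right₀ _ hε0.ne'] at h5
  linarith

theorem norm_iteratedFDeriv_succ_le_of_landau {f : E → G} {n : ℕ} {a b : ℝ}
    (hf : ContDiff ℝ (n + 2 : ℕ) f)
    (ha : ∀ x ∈ Metric.ball (0 : E) 1, ‖iteratedFDeriv ℝ n f x‖ ≤ a)
    (hb : ∀ x ∈ Metric.ball (0 : E) 1, ‖iteratedFDeriv ℝ (n + 2) f x‖ ≤ b) {x : E}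
    (hx : x ∈ Metric.ball (0 : E) (1 / 2)) : ‖iteratedFDeriv ℝ (n + 1) f x‖ ≤ 4 * a + b / 2 := by
  rw [← norm_fderiv_iteratedFDeriv]
  have h1 : Differentiable ℝ (iteratedFDeriv ℝ n f) :=
    hf.differentiable_iteratedFDeriv (by exact_mod_cast (by omega : n < n + 2))
  have h2 : Differentiable ℝ (iteratedFDeriv ℝ (n + 1) f) :=
    hf.differentiable_iteratedFDeriv (by exact_mod_cast (by omega : n + 1 < n + 2))
  refine norm_fderiv_le_of_norm_le_of_norm_fderiv_fderiv_le h1 ?_ ha (fun y hy => ?_) hx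
  · rw [fderiv_iteratedFDeriv]
    exact (LinearIsometryEquiv.differentiable _).comp h2
  · rw [fderiv_iteratedFDeriv, LinearIsometryEquiv.comp_fderiv]
    refine (ContinuousLinearMap.opNorm_le_bound _ ((norm_nonneg _).trans (hb y hy)) fun v => ?_)
    change ‖(continuousMultilinearCurryLeftEquiv ℝ (fun _ : Fin (n + 1) => E) G)
      (fderiv ℝ (iteratedFDeriv ℝ (n + 1) f) y v)‖ ≤ _
    rw [LinearIsometryEquiv.norm_map]
    refine (ContinuousLinearMap.le_opNorm _ _).trans ?_
    rw [norm_fderiv_iteratedFDeriv]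
    exact mul_le_mul_of_nonneg_right (hb y hy) (norm_nonneg _)

/-- Derivatives bounded at the origin, together with a bound of the top derivative on the unit
ball, are bounded on the unit ball. -/
theorem norm_iteratedFDeriv_le_of_top_le {f : E → G} {p : ℕ} {a : ℝ}
    (hf : ContDiff ℝ p f) (ha : 0 ≤ a)
    (h0 : ∀ i, 1 ≤ i → i < p → ‖iteratedFDeriv ℝ i f 0‖ ≤ a)
    (hp : ∀ x ∈ Metric.ball (0 : E) 1, ‖iteratedFDeriv ℝ p f x‖ ≤ a) (k : ℕ) :
    ∀ i, 1 ≤ i → i + k = p → ∀ x ∈ Metric.ball (0 : E) 1,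
      ‖iteratedFDeriv ℝ i f x‖ ≤ (k + 1) * a := by
  induction k with
  | zero =>
    intro i _ hi x hx
    obtain rfl : i = p := by omega
    simpa using hp x hx
  | succ k ih =>
    intro i h1 hi x hx
    have hd : Differentiable ℝ (iteratedFDeriv ℝ i f) :=
      hf.differentiable_iteratedFDeriv (by exact_mod_cast (by omega : i < p))
    have hb := (convex_ball (0 : E) 1).norm_image_sub_le_of_norm_fderiv_le (C := (k + 1) * a)
      (fun z _ => hd z) (fun z hz => by
        rw [norm_fderiv_iteratedFDeriv]; exact ih (i + 1) (by omega) (by omega) z hz)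
      (Metric.mem_ball_self one_pos) hx
    rw [sub_zero] at hb
    have hx' := (mem_ball_zero_iff.1 hx).le
    have h3 : (k + 1) * a * ‖x‖ ≤ (k + 1) * a := mul_le_of_le_one_right (by positivity) hx'
    have h4 := norm_sub_norm_le (iteratedFDeriv ℝ i f x) (iteratedFDeriv ℝ i f 0)
    have h5 := h0 i h1 (by omega)
    push_cast
    linarith

end Interpolation

/-! ### The state space and its rescaling. -/

section StateSpace

variable {d : ℕ}

instance (d : ℕ) : ContinuousSMul ℝ (State d) :=
  @IsBoundedSMul.continuousSMul ℝ (State d) _ _ _ _ _ (NormedSpace.toIsBoundedSMul)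

theorem velocity_mkState (v x : Vec d) (t : ℝ) : velocity (mkState v x t) = v := rfl

theorem position_mkState (v x : Vec d) (t : ℝ) : position (mkState v x t) = x := rfl

theorem time_mkState (v x : Vec d) (t : ℝ) : time (mkState v x t) = t := rfl

theorem mkState_eta (y : State d) : mkState (velocity y) (position y) (time y) = y := rfl

theorem mkState_add (v x v' x' : Vec d) (t t' : ℝ) :
    mkState v x t + mkState v' x' t' = mkState (v + v') (x + x') (t + t') := rfl

theorem smul_mkState (a : ℝ) (v x : Vec d) (t : ℝ) :
    a • mkState v x t = mkState (a • v) (a • x) (a * t) := rfl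

theorem norm_velocity_le (y : State d) : ‖velocity y‖ ≤ ‖y‖ := WithLp.norm_fst_le (x := y)

theorem norm_position_le (y : State d) : ‖position y‖ ≤ ‖y‖ :=
  (WithLp.norm_fst_le (x := y.snd)).trans (WithLp.norm_snd_le (x := y))

theorem norm_time_le (y : State d) : ‖time y‖ ≤ ‖y‖ :=
  (WithLp.norm_snd_le (x := y.snd)).trans (WithLp.norm_snd_le (x := y))

theorem norm_mkState_sq (v x : Vec d) (t : ℝ) :
    ‖mkState v x t‖ ^ 2 = ‖v‖ ^ 2 + (‖x‖ ^ 2 + ‖t‖ ^ 2) := by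
  rw [WithLp.prod_norm_sq_eq_of_L2, WithLp.prod_norm_sq_eq_of_L2]
  rfl

/-- The velocity component as a continuous linear map. -/
noncomputable def velocityL (d : ℕ) : State d →L[ℝ] Vec d :=
  LinearMap.mkContinuous ⟨⟨velocity, fun _ _ => rfl⟩, fun _ _ => rfl⟩ 1 fun y => by
    rw [one_mul]; exact norm_velocity_le y

/-- The position component as a continuous linear map. -/
noncomputable def positionL (d : ℕ) : State d →L[ℝ] Vec d :=
  LinearMap.mkContinuous ⟨⟨position, fun _ _ => rfl⟩, fun _ _ => rfl⟩ 1 fun y => by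
    rw [one_mul]; exact norm_position_le y

/-- The time component as a continuous linear map. -/
noncomputable def timeL (d : ℕ) : State d →L[ℝ] ℝ :=
  LinearMap.mkContinuous ⟨⟨time, fun _ _ => rfl⟩, fun _ _ => rfl⟩ 1 fun y => by
    rw [one_mul]; exact norm_time_le y

theorem norm_mkState_left (v : Vec d) : ‖mkState v 0 0‖ = ‖v‖ := by
  rw [← sq_eq_sq₀ (norm_nonneg _) (norm_nonneg _), norm_mkState_sq]
  simp

theorem norm_mkState_middle (x : Vec d) : ‖mkState 0 x 0‖ = ‖x‖ := by
  rw [← sq_eq_sq₀ (norm_nonneg _) (norm_nonneg _), norm_mkState_sq]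
  simp

theorem norm_mkState_right (t : ℝ) : ‖mkState (0 : Vec d) 0 t‖ = ‖t‖ := by
  rw [← sq_eq_sq₀ (norm_nonneg _) (norm_nonneg _), norm_mkState_sq]
  simp

/-- The inclusion of the velocities into the states. -/
noncomputable def ofVelocityL (d : ℕ) : Vec d →L[ℝ] State d :=
  LinearMap.mkContinuous ⟨⟨fun v => mkState v 0 0, fun v w => by simp [mkState_add]⟩,
    fun a v => by simp [smul_mkState]⟩ 1 fun v => by
    rw [one_mul]; exact (norm_mkState_left v).le

/-- The inclusion of the positions into the states. -/
noncomputable def ofPositionL (d : ℕ) : Vec d →L[ℝ] State d :=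
  LinearMap.mkContinuous ⟨⟨fun x => mkState 0 x 0, fun v w => by simp [mkState_add]⟩,
    fun a v => by simp [smul_mkState]⟩ 1 fun v => by
    rw [one_mul]; exact (norm_mkState_middle v).le

/-- Multiplication of the three components of a state by `a`, `a` and `b`. -/
noncomputable def scaleL (d : ℕ) (a b : ℝ) : State d →L[ℝ] State d :=
  a • ((ofVelocityL d).comp (velocityL d) + (ofPositionL d).comp (positionL d)) +
    b • (timeL d).smulRight (mkState 0 0 1)

theorem scaleL_apply (a b : ℝ) (z : State d) :
    scaleL d a b z = mkState (a • velocity z) (a • position z) (b * time z) := by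
  change a • (mkState (velocity z) 0 0 + mkState 0 (position z) 0) + b • (time z • mkState 0 0 1) = _
  simp [mkState_add, smul_mkState]

/-- The rescaling `[v; x; t] ↦ [v / c; x / c; c t]`. -/
noncomputable def rescale (d : ℕ) {c : ℝ} (hc : c ≠ 0) : State d ≃L[ℝ] State d :=
  ContinuousLinearEquiv.equivOfInverse (scaleL d c⁻¹ c) (scaleL d c c⁻¹)
    (fun z => by
      simp only [scaleL_apply, velocity_mkState, position_mkState, time_mkState, smul_smul,
        ← mul_assoc, mul_inv_cancel₀ hc, inv_mul_cancel₀ hc, one_smul, one_mul, mkState_eta])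
    (fun z => by
      simp only [scaleL_apply, velocity_mkState, position_mkState, time_mkState, smul_smul,
        ← mul_assoc, mul_inv_cancel₀ hc, inv_mul_cancel₀ hc, one_smul, one_mul, mkState_eta])

theorem rescale_apply {c : ℝ} (hc : c ≠ 0) (z : State d) :
    rescale d hc z = mkState (c⁻¹ • velocity z) (c⁻¹ • position z) (c * time z) :=
  scaleL_apply _ _ z

end StateSpace

/-! ### The vector field in scaled coordinates. -/

section ScaledField

variable {d : ℕ}

/-- The field of the system in the coordinates in which position, velocity and time are scaled
by `1/c`, `1/c` and `c`, up to the factor `K`. -/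
noncomputable def scaledField (p : ℕ) (c K : ℝ) (v₀ : Vec d) (φ : Vec d → ℝ) (z : State d) :
    State d :=
  mkState
    (-((((2 * p + 1 : ℝ) / c) * (1 + time z)⁻¹) • (K⁻¹ • (v₀ + velocity z)))
      - ((p : ℝ) ^ 2 * (1 + time z) ^ (p - 2)) • (K⁻¹ • gradient φ (position z)))
    (K⁻¹ • (v₀ + velocity z)) (K⁻¹ * c⁻¹)

theorem gradient_scaled {f : Vec d → ℝ} (hf : Differentiable ℝ f) (a b : ℝ) (xc ξ : Vec d) :
    gradient (fun ξ => a * f (xc + b • ξ)) ξ = (a * b) • gradient f (xc + b • ξ) := by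
  have h1 : HasGradientAt f (gradient f (xc + b • ξ)) (xc + b • ξ) := (hf _).hasGradientAt
  refine HasGradientAt.gradient ?_
  rw [hasGradientAt_iff_hasFDerivAt] at h1 ⊢
  have h2 : HasFDerivAt (fun ξ : Vec d => xc + b • ξ) (b • ContinuousLinearMap.id ℝ (Vec d)) ξ :=
    ((hasFDerivAt_id ξ).const_smul b).const_add xc
  have h3 := (h1.comp ξ h2).const_mul a
  refine h3.congr_fderiv ?_
  ext w
  simp [mul_assoc]

/-- Homogeneity of the system: in the gradient term the powers of c combine as c^(p-2) = c⁻¹ ·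
c^(p-1), and c^(p-1) is what differentiating the scaled objective produces. -/
theorem field_conj {p : ℕ} (hp : 2 ≤ p) {f : Vec d → ℝ} (hf : Differentiable ℝ f) {c K : ℝ}
    (hc : c ≠ 0) (hK : K ≠ 0) (vc xc : Vec d) (z : State d) :
    field p f (mkState vc xc c + rescale d hc z) =
      K • rescale d hc
        (scaledField p c K (c • vc) (fun ξ => c ^ p * f (xc + c⁻¹ • ξ)) z) := by
  rw [rescale_apply, rescale_apply, mkState_add, field, scaledField]
  simp only [velocity_mkState, position_mkState, time_mkState, smul_mkState]
  rw [gradient_scaled hf]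
  have hv : vc + c⁻¹ • velocity z = c⁻¹ • (c • vc + velocity z) := by
    rw [smul_add, smul_smul, inv_mul_cancel₀ hc, one_smul]
  have ht : c + c * time z = c * (1 + time z) := by ring
  obtain ⟨q, rfl⟩ : ∃ q, p = q + 2 := ⟨p - 2, by omega⟩
  rw [hv, ht]
  congr 1
  · simp only [smul_sub, smul_neg, smul_smul, Nat.add_sub_cancel, mul_pow]
    congr 2
    · congr 1
      rw [div_eq_mul_inv, div_eq_mul_inv, mul_inv]
      field_simp
    · field_simp
      ring
  · rw [smul_smul, smul_smul]
    congr 1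
    field_simp
  · field_simp

/-- The velocity and the gradient are of size K, which the factor K⁻¹ cancels. The time coefficients
are fixed smooth functions on [-1/2, 1/2], where 1 + σ stays away from 0. Hence the constant depends
on p and n only. -/
theorem exists_scaledField_derivBoundOn (p n : ℕ) :
    ∃ C : ℝ, 0 ≤ C ∧ ∀ (d : ℕ) (c K : ℝ) (v₀ : Vec d) (φ : Vec d → ℝ), 1 ≤ c → 1 ≤ K →
      ‖v₀‖ ≤ 2 * p * K →
      DerivBoundOn n (p + 5) (fun ξ => K⁻¹ • gradient φ ξ) (Metric.ball 0 (1 / 2)) →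
      DerivBoundOn n C (scaledField p c K v₀ φ) (Metric.ball 0 (1 / 2)) := by
  have hI : IsOpen (Ioo (-(1 / 2) : ℝ) (1 / 2)) := isOpen_Ioo
  have hIu : UniqueDiffOn ℝ (Icc (-(1 / 2) : ℝ) (1 / 2)) := uniqueDiffOn_Icc (by norm_num)
  obtain ⟨C₁, hC₁, h₁⟩ := exists_derivBoundOn_of_isCompact (n := n)
    (f := fun σ : ℝ => (1 + σ)⁻¹) hI Ioo_subset_Icc_self isCompact_Icc hIu (by
      refine ContDiffOn.inv (contDiffOn_const.add contDiffOn_id) fun x hx => ?_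
      have := hx.1
      change 1 + x ≠ 0
      linarith)
  obtain ⟨C₂, hC₂, h₂⟩ := exists_derivBoundOn_of_isCompact (n := n)
    (f := fun σ : ℝ => (p : ℝ) ^ 2 * (1 + σ) ^ (p - 2)) hI Ioo_subset_Icc_self isCompact_Icc hIu
    (contDiffOn_const.mul ((contDiffOn_const.add contDiffOn_id).pow _))
  set Cv : ℝ := 2 * p + 1 with hCv
  set B : ℝ := 2 ^ n * ((2 * p + 1) * (n.factorial * C₁) * Cv) +
    2 ^ n * (n.factorial * C₂ * (n.factorial * (p + 5))) with hB
  refine ⟨1 * B + 1 * Cv + 1, by positivity, ?_⟩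
  intro d c K v₀ φ hc hK hv₀ hφ
  have hu : UniqueDiffOn ℝ (Metric.ball (0 : State d) (1 / 2)) := Metric.isOpen_ball.uniqueDiffOn
  have hc0 : 0 < c := by linarith
  have hK0 : 0 < K := by linarith
  have hKi : K⁻¹ ≤ 1 := inv_le_one_of_one_le₀ hK
  have hci : c⁻¹ ≤ 1 := inv_le_one_of_one_le₀ hc
  have hvn : ‖velocityL d‖ ≤ 1 := LinearMap.mkContinuous_norm_le _ zero_le_one _
  have hxn : ‖positionL d‖ ≤ 1 := LinearMap.mkContinuous_norm_le _ zero_le_one _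
  have htn : ‖timeL d‖ ≤ 1 := LinearMap.mkContinuous_norm_le _ zero_le_one _
  have hjv : ‖ofVelocityL d‖ ≤ 1 := LinearMap.mkContinuous_norm_le _ zero_le_one _
  have hjx : ‖ofPositionL d‖ ≤ 1 := LinearMap.mkContinuous_norm_le _ zero_le_one _
  have htm : MapsTo (timeL d) (Metric.ball 0 (1 / 2)) (Ioo (-(1 / 2) : ℝ) (1 / 2)) := by
    intro z hz
    rw [mem_ball_zero_iff] at hz
    have := (norm_time_le z).trans_lt hz
    rw [Real.norm_eq_abs, abs_lt] at this
    exact this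
  have hxm : MapsTo (positionL d) (Metric.ball 0 (1 / 2)) (Metric.ball 0 (1 / 2)) := by
    intro z hz
    rw [mem_ball_zero_iff] at hz ⊢
    exact (norm_position_le z).trans_lt hz
  have hv : DerivBoundOn n Cv (fun z : State d => K⁻¹ • (v₀ + velocity z))
      (Metric.ball 0 (1 / 2)) := by
    have h3 : DerivBoundOn n 1 (fun z : State d => velocityL d z) (Metric.ball 0 (1 / 2)) :=
      derivBoundOn_clm hu _ hvn fun z hz => by
        rw [mem_ball_zero_iff] at hz
        exact (norm_velocity_le z).trans (by linarith)
    refine (((DerivBoundOn.const v₀).add hu h3).const_smul hu K⁻¹).mono ?_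
    rw [abs_of_pos (inv_pos.2 hK0), inv_mul_le_iff₀ hK0]
    nlinarith
  have ht1 : DerivBoundOn n (n.factorial * C₁) (fun z : State d => (1 + time z)⁻¹)
      (Metric.ball 0 (1 / 2)) := h₁.comp_clm hu hI.uniqueDiffOn hC₁ (timeL d) htn htm
  have ht2 : DerivBoundOn n (n.factorial * C₂)
      (fun z : State d => (p : ℝ) ^ 2 * (1 + time z) ^ (p - 2))
      (Metric.ball 0 (1 / 2)) := h₂.comp_clm hu hI.uniqueDiffOn hC₂ (timeL d) htn htm
  have ht3 : DerivBoundOn n ((2 * p + 1) * (n.factorial * C₁))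
      (fun z : State d => ((2 * p + 1 : ℝ) / c) * (1 + time z)⁻¹) (Metric.ball 0 (1 / 2)) := by
    refine (ht1.const_smul hu ((2 * p + 1 : ℝ) / c)).mono ?_
    refine mul_le_mul_of_nonneg_right ?_ (by positivity)
    rw [abs_of_pos (by positivity)]
    exact div_le_self (by positivity) hc
  have hgr : DerivBoundOn n (n.factorial * (p + 5))
      (fun z : State d => K⁻¹ • gradient φ (position z)) (Metric.ball 0 (1 / 2)) :=
    hφ.comp_clm hu Metric.isOpen_ball.uniqueDiffOn (by positivity) (positionL d) hxn hxm
  have hA := (((ht3.smul hu (by positivity) (by positivity) hv).neg hu).sub hu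
    (ht2.smul hu (by positivity) (by positivity) hgr))
  have h5 := ((hA.clm_comp hu (ofVelocityL d)).add hu (hv.clm_comp hu (ofPositionL d))).add hu
    (DerivBoundOn.const (mkState (0 : Vec d) 0 (K⁻¹ * c⁻¹)))
  refine (h5.mono ?_).congr fun z _ => ?_
  · refine add_le_add (add_le_add ?_ ?_) ?_
    · exact mul_le_mul_of_nonneg_right hjv (by positivity)
    · exact mul_le_mul_of_nonneg_right hjx (by positivity)
    · rw [norm_mkState_right, Real.norm_of_nonneg (by positivity)]
      exact mul_le_one₀ hKi (by positivity) hci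
  · rw [scaledField]
    change _ = mkState _ 0 0 + mkState 0 _ 0 + mkState 0 0 _
    simp [mkState_add]

end ScaledField

/-! ### Exactness in the time component. -/

/-- Test the order condition on y' = 1, where the error is h(∑ bᵢ - 1) and has to be O(h^{s+1}) with
s ≥ 1. -/
theorem RungeKutta.HasOrder.sum_b_eq_one {S s : ℕ} {rk : RungeKutta S} (hs : 1 ≤ s)
    (ho : rk.HasOrder s) : ∑ i, rk.b i = 1 := by
  have h := ho ℝ (fun _ => 1) contDiff_const 0 (fun t => t) rfl
    (Eventually.of_forall fun t => hasDerivAt_id t)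
  simp only [step, smul_eq_mul, mul_one, zero_add] at h
  have h1 : (fun t : ℝ => t * (∑ i, rk.b i - 1)) =O[𝓝[>] 0] fun t : ℝ => t * t ^ s :=
    h.congr (fun t => by ring) (fun t => by ring)
  have h2 : (fun _ : ℝ => ∑ i, rk.b i - 1) =O[𝓝[>] 0] fun t : ℝ => t ^ s := by
    refine ((isBigO_refl (fun t : ℝ => t⁻¹) (𝓝[>] 0)).mul h1).congr' ?_ ?_ <;>
    · filter_upwards [self_mem_nhdsWithin] with t ht
      have ht' : t ≠ 0 := ne_of_gt ht
      rw [inv_mul_cancel_left₀ ht']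
  have h3 : Tendsto (fun t : ℝ => t ^ s) (𝓝[>] 0) (𝓝 0) := by
    have : Continuous fun t : ℝ => t ^ s := by fun_prop
    simpa [zero_pow (by omega : s ≠ 0)] using
      tendsto_nhdsWithin_of_tendsto_nhds (s := Ioi 0) (this.tendsto 0)
  have h4 := tendsto_nhds_unique tendsto_const_nhds (h2.trans_tendsto h3)
  linarith

section TimeComponent

variable {d : ℕ} {p : ℕ} {f : Vec d → ℝ} {h : ℝ} {yc : State d}

theorem time_step_field {S : ℕ} {rk : RungeKutta S} (hb : ∑ i, rk.b i = 1) :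
    time (rk.step (field p f) h yc) = time yc + h := by
  change timeL d (rk.step (field p f) h yc) = timeL d yc + h
  rw [RungeKutta.step, map_add, map_smul, map_sum]
  have : ∀ i, timeL d (rk.b i • field p f (rk.stage (field p f) h yc i)) = rk.b i := fun i => by
    rw [map_smul]
    exact mul_one _
  simp only [this, hb, smul_eq_mul, mul_one]

theorem IsSolutionOn.time_eq (hh : 0 ≤ h) {φ : ℝ → State d}
    (hφ : IsSolutionOn (field p f) yc h φ) : time (φ h) = time yc + h := by
  have h1 : ∀ t ∈ Icc 0 h, HasDerivWithinAt (fun t => timeL d (φ t) - t) (0 : ℝ) (Icc 0 h) t := by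
    intro t ht
    have := ((timeL d).hasFDerivAt.comp_hasDerivWithinAt t (hφ.2 t ht)).sub
      (hasDerivWithinAt_id t (Icc 0 h))
    have e : timeL d (field p f (φ t)) - 1 = 0 := sub_self _
    rw [e] at this
    exact this
  have h2 := (convex_Icc (0 : ℝ) h).norm_image_sub_le_of_norm_hasDerivWithin_le (C := 0) h1
    (fun t _ => by simp) (left_mem_Icc.2 hh) (right_mem_Icc.2 hh)
  rw [zero_mul, norm_le_zero_iff, hφ.1] at h2
  change timeL d (φ h) = timeL d yc + h
  linarith

end TimeComponent

/-- Time is the only component that is multiplied by c rather than divided by it; this lemma is the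
source of the factor 1/t_c in the final bound. -/
theorem norm_rescale_of_time_eq_zero {d : ℕ} {c : ℝ} (hc : 0 < c) {z : State d}
    (hz : time (rescale d hc.ne' z) = 0) : ‖rescale d hc.ne' z‖ = c⁻¹ * ‖z‖ := by
  have h0 : time z = 0 := by
    rw [rescale_apply, time_mkState] at hz
    exact (mul_eq_zero.1 hz).resolve_left hc.ne'
  have : rescale d hc.ne' z = c⁻¹ • z := by
    rw [rescale_apply, h0, mul_zero]
    conv_rhs => rw [← mkState_eta z, smul_mkState, h0, mul_zero]
  rw [this, norm_smul, Real.norm_of_nonneg (inv_nonneg.2 hc.le)]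

/-! ### Derivative bounds for the scaled objective. -/

section ScaledObjective

variable {d : ℕ} {f : Vec d → ℝ} {p s : ℕ} {c : ℝ} {xc : Vec d}

theorem norm_iteratedFDeriv_scaled_le (hc : 0 < c) {i : ℕ} (hf : ContDiff ℝ i f) (ξ : Vec d) :
    ‖iteratedFDeriv ℝ i (fun ξ => c ^ p * f (xc + c⁻¹ • ξ)) ξ‖ ≤
      c ^ p * (c⁻¹) ^ i * ‖iteratedFDeriv ℝ i f (xc + c⁻¹ • ξ)‖ := by
  set T : Vec d →L[ℝ] Vec d := c⁻¹ • ContinuousLinearMap.id ℝ (Vec d) with hT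
  have hTn : ‖T‖ ≤ c⁻¹ := by
    refine ContinuousLinearMap.opNorm_le_bound _ (inv_nonneg.2 hc.le) fun v => ?_
    simp [hT, norm_smul, abs_of_pos hc]
  have hF : ContDiff ℝ i fun w => f (xc + w) := hf.comp (contDiff_const.add contDiff_id)
  have e : (fun ξ => c ^ p * f (xc + c⁻¹ • ξ)) = (c ^ p) • ((fun w => f (xc + w)) ∘ T) := by
    ext ξ
    simp [hT]
  rw [e, iteratedFDeriv_const_smul_apply (hF.comp T.contDiff).contDiffAt,
    T.iteratedFDeriv_comp_right hF ξ le_rfl, iteratedFDeriv_comp_add_left, norm_smul,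
    Real.norm_of_nonneg (by positivity), mul_assoc]
  refine mul_le_mul_of_nonneg_left ?_ (by positivity)
  refine (ContinuousMultilinearMap.norm_compContinuousLinearMap_le _ _).trans ?_
  rw [Finset.prod_const, Finset.card_univ, Fintype.card_fin, mul_comm]
  refine mul_le_mul ?_ (by simp [hT]) (norm_nonneg _) (by positivity)
  exact pow_le_pow_left₀ (norm_nonneg _) hTn i

/-- The growth exponent q = p/(p-i) matches the scaling: (c^(p-i) N)^q = c^p N^q ≤ L c^p Δ ≤ K ≤
K^q. -/
theorem le_of_growth {N L Δ K E : ℝ} {i : ℕ} (hc : 0 < c) (hi : i < p) (hL : 0 < L)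
    (hN : 0 ≤ N) (hK : 1 ≤ K) (hE : c ^ p * Δ ≤ E) (hLE : L * E ≤ K)
    (hg : 1 / L * N ^ ((p : ℝ) / ((p : ℝ) - (i : ℝ))) ≤ Δ) : c ^ p * (c⁻¹) ^ i * N ≤ K := by
  have hpi : (0 : ℝ) < (p : ℝ) - i := by
    have : (i : ℝ) < p := by exact_mod_cast hi
    linarith
  set q : ℝ := (p : ℝ) / ((p : ℝ) - i) with hq
  have hq1 : 1 ≤ q := by
    rw [hq, le_div_iff₀ hpi, one_mul]
    have : (0 : ℝ) ≤ i := Nat.cast_nonneg i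
    linarith
  have hcp : c ^ p * (c⁻¹) ^ i = c ^ ((p : ℝ) - i) := by
    rw [Real.rpow_sub hc, Real.rpow_natCast, Real.rpow_natCast, inv_pow, div_eq_mul_inv]
  rw [← Real.rpow_le_rpow_iff (z := q) (by positivity) (by linarith) (by linarith)]
  have h1 : (c ^ p * (c⁻¹) ^ i * N) ^ q = c ^ p * N ^ q := by
    rw [Real.mul_rpow (by positivity) hN, hcp, ← Real.rpow_mul hc.le, hq,
      mul_div_cancel₀ _ hpi.ne', Real.rpow_natCast]
  have h2 : N ^ q ≤ L * Δ := by
    rw [one_div, inv_mul_le_iff₀ hL] at hg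
    exact hg
  rw [h1]
  calc c ^ p * N ^ q ≤ c ^ p * (L * Δ) := by gcongr
    _ = L * (c ^ p * Δ) := by ring
    _ ≤ L * E := by gcongr
    _ ≤ K := hLE
    _ = K ^ (1 : ℝ) := (Real.rpow_one K).symm
    _ ≤ K ^ q := Real.rpow_le_rpow_of_exponent_le hK hq1

theorem norm_iteratedFDeriv_scaled_le_of_growth {xs : Vec d} {A : Set (Vec d)} {L M E K : ℝ}
    (hL : 0 < L) (hc : 1 ≤ c) (hg : GrowthOn p L f xs A)
    (hd : DifferentiableBoundedOn p s M f A) (hA : Metric.closedBall xc (1 / c) ⊆ A)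
    (hE : c ^ p * (f xc - f xs) ≤ E) (hLE : L * E ≤ K) (hK : 1 ≤ K) (hMK : M ≤ K) {i : ℕ}
    (hi : 1 ≤ i) (his : i ≤ s + 2) {ξ : Vec d} (hξ : ξ ∈ Metric.ball (0 : Vec d) (1 / 2)) :
    ‖iteratedFDeriv ℝ i (fun ξ => c ^ p * f (xc + c⁻¹ • ξ)) ξ‖ ≤ (p + 5) * K := by
  have hc0 : 0 < c := by linarith
  have hK0 : 0 < K := by linarith
  have hfi : ∀ j, j ≤ max p (s + 2) → ContDiff ℝ j f := fun j hj => hd.1.of_le (by exact_mod_cast hj)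
  have hφ : ∀ j, j ≤ max p (s + 2) → ContDiff ℝ j fun ξ => c ^ p * f (xc + c⁻¹ • ξ) := fun j hj =>
    contDiff_const.mul ((hfi j hj).comp (contDiff_const.add (contDiff_const_smul _)))
  have hmem : ∀ ξ ∈ Metric.ball (0 : Vec d) 1, xc + c⁻¹ • ξ ∈ A := fun ξ hξ => hA (by
    rw [mem_closedBall_iff_norm, add_sub_cancel_left, norm_smul, Real.norm_of_nonneg (by positivity),
      one_div]
    exact mul_le_of_le_one_right (by positivity) (mem_ball_zero_iff.1 hξ).le)
  have hhigh : ∀ j, p ≤ j → (j = p ∨ j ≤ s ∨ j = s + 2) → ∀ ξ ∈ Metric.ball (0 : Vec d) 1,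
      ‖iteratedFDeriv ℝ j (fun ξ => c ^ p * f (xc + c⁻¹ • ξ)) ξ‖ ≤ K := by
    intro j hpj hj ξ hξ
    refine (norm_iteratedFDeriv_scaled_le hc0 (hfi j (by omega)) ξ).trans ?_
    -- From order p on, the scaling only shrinks derivatives, because c ≥ 1.
    have h1 : c ^ p * (c⁻¹) ^ j ≤ 1 := by
      rw [inv_pow, mul_inv_le_iff₀ (by positivity), one_mul]
      exact pow_le_pow_right₀ hc hpj
    exact (mul_le_of_le_one_left (norm_nonneg _) h1).trans ((hd.2 _ (hmem ξ hξ) j hpj hj).trans hMK)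
  have hξ1 : ξ ∈ Metric.ball (0 : Vec d) 1 := Metric.ball_subset_ball (by norm_num) hξ
  have hp0 : (0 : ℝ) ≤ p := Nat.cast_nonneg p
  rcases le_or_gt i p with hip | hip
  -- The energy controls the gap f - f(x*) at the centre only, so growth is used at ξ = 0 and the
  -- bound on order p propagates it to the ball.
  · have h0 : ∀ j, 1 ≤ j → j < p →
        ‖iteratedFDeriv ℝ j (fun ξ => c ^ p * f (xc + c⁻¹ • ξ)) 0‖ ≤ K := by
      intro j hj hjp
      refine (norm_iteratedFDeriv_scaled_le hc0 (hfi j (by omega)) 0).trans ?_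
      rw [smul_zero, add_zero]
      refine le_of_growth hc0 hjp hL (norm_nonneg _) hK hE hLE (hg xc (hA ?_) j hj hjp)
      exact Metric.mem_closedBall_self (by positivity)
    have h1 := norm_iteratedFDeriv_le_of_top_le (hφ p (le_max_left _ _)) hK0.le h0
      (hhigh p le_rfl (Or.inl rfl)) (p - i) i hi (by omega) ξ hξ1
    refine h1.trans (mul_le_mul_of_nonneg_right ?_ hK0.le)
    have : ((p - i : ℕ) : ℝ) ≤ p := by exact_mod_cast Nat.sub_le p i
    linarith
  -- Here s + 1 > p, so orders s and s + 2 are both bounded. The Landau inequality gives 4K + K/2,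
  -- which fits under (p + 5) K.
  · rcases eq_or_ne i (s + 1) with rfl | hi1
    · have h1 := norm_iteratedFDeriv_succ_le_of_landau (hφ (s + 2) (le_max_right _ _))
        (hhigh s (by omega) (by omega)) (hhigh (s + 2) (by omega) (by omega)) hξ
      refine h1.trans ?_
      nlinarith
    · refine (hhigh i hip.le (by omega) ξ hξ1).trans ?_
      nlinarith

theorem derivBoundOn_gradient {φ : Vec d → ℝ} {n : ℕ} {B : ℝ} {U : Set (Vec d)} (hU : IsOpen U)
    (hφ : ContDiff ℝ (n + 1 : ℕ) φ)
    (hB : ∀ i, 1 ≤ i → i ≤ n + 1 → ∀ ξ ∈ U, ‖iteratedFDeriv ℝ i φ ξ‖ ≤ B) :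
    DerivBoundOn n B (gradient φ) U := by
  have e : gradient φ = (InnerProductSpace.toDual ℝ (Vec d)).symm ∘ fderiv ℝ φ := rfl
  refine ⟨?_, fun k hk ξ hξ => ?_⟩
  · rw [e]
    exact ((InnerProductSpace.toDual ℝ (Vec d)).symm.contDiff.comp
      (hφ.fderiv_right (by push_cast; exact le_rfl))).contDiffOn
  · rw [iteratedFDerivWithin_of_isOpen k hU hξ, e,
      LinearIsometryEquiv.norm_iteratedFDeriv_comp_left, norm_iteratedFDeriv_fderiv]
    exact hB (k + 1) (by omega) (by omega) ξ hξ

end ScaledObjective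

/-! ### Consequences of the energy, and the main theorem. -/

theorem norm_velocity_sq_le_lyapunov {d p : ℕ} (hp : 2 ≤ p) {f : Vec d → ℝ} {xs : Vec d}
    (hmin : ∀ x, f xs ≤ f x) {y : State d} (hy : 0 ≤ time y) :
    ‖time y • velocity y‖ ^ 2 ≤ 4 * (p : ℝ) ^ 2 * lyapunov p f xs y := by
  have hp0 : (0 : ℝ) < 4 * (p : ℝ) ^ 2 := by positivity
  have h1 : time y ^ 2 / (4 * (p : ℝ) ^ 2) * ‖velocity y‖ ^ 2 ≤ lyapunov p f xs y := by
    have h2 : 0 ≤ time y ^ p * (f (position y) - f xs) :=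
      mul_nonneg (pow_nonneg hy _) (sub_nonneg.2 (hmin _))
    have h3 := sq_nonneg ‖position y + (time y / (2 * p)) • velocity y - xs‖
    unfold lyapunov
    linarith
  have h2 := mul_le_mul_of_nonneg_left h1 hp0.le
  refine le_trans (le_of_eq ?_) h2
  rw [norm_smul, mul_pow, Real.norm_of_nonneg hy]
  field_simp

theorem gap_le_lyapunov {d p : ℕ} {f : Vec d → ℝ} {xs : Vec d} (y : State d) :
    time y ^ p * (f (position y) - f xs) ≤ lyapunov p f xs y := by
  unfold lyapunov
  have h1 := sq_nonneg ‖position y + (time y / (2 * p)) • velocity y - xs‖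
  have h2 : 0 ≤ time y ^ 2 / (4 * (p : ℝ) ^ 2) * ‖velocity y‖ ^ 2 := by positivity
  linarith

end RKAccel

theorem mainTheorem2 (p : ℕ) (hp : 2 ≤ p) :
    ∃ C₀ : ℝ, 0 < C₀ ∧
      ∀ (s : ℕ), 1 ≤ s → ∀ (S : ℕ) (rk : RKAccel.RungeKutta S), rk.HasOrder s →
      ∃ C : ℝ, 0 < C ∧
        ∀ (d : ℕ) (f : RKAccel.Vec d → ℝ) (xs : RKAccel.Vec d) (A : Set (RKAccel.Vec d))
          (L M : ℝ), 0 < L → 0 ≤ M → (∀ x, f xs ≤ f x) →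
          RKAccel.GrowthOn p L f xs A → RKAccel.DifferentiableBoundedOn p s M f A →
          ∀ (vc xc : RKAccel.Vec d) (tc : ℝ), 1 ≤ tc → Metric.closedBall xc (1 / tc) ⊆ A →
          ∀ (yc : RKAccel.State d) (E h : ℝ), yc = RKAccel.mkState vc xc tc →
            E = RKAccel.lyapunov p f xs yc →
            0 < h → h ≤ min 0.2 (1 / ((1 + rk.kappa) * C₀ * (E + 1) * (L + M + 1))) →
            (∃ φ : ℝ → RKAccel.State d, RKAccel.IsSolutionOn (RKAccel.field p f) yc h φ) ∧
            ∀ φ : ℝ → RKAccel.State d, RKAccel.IsSolutionOn (RKAccel.field p f) yc h φ →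
              ‖rk.step (RKAccel.field p f) h yc - φ h‖ ≤
                h ^ (s + 1) *
                  (C * ((1 + E) ^ (s + 1) * (L + M + 1) ^ (s + 1)
                    + h * (1 + E) ^ (s + 2) * (L + M + 1) ^ (s + 2)) / tc) := by
  open RKAccel in
  obtain ⟨c₁, hc₁, hfield₀⟩ := exists_scaledField_derivBoundOn p 0
  -- Only the sup bound c₁ of the scaled field (n = 0) enters, so C₀ depends on p alone. The summand
  -- 1 makes the bound strict for the barrier argument, and the factor 4 keeps displacements below
  -- the radius 1/2.
  refine ⟨4 * (c₁ + 1), by positivity, fun s hs S rk ho => ?_⟩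
  obtain ⟨c₂, hc₂, hfield⟩ := exists_scaledField_derivBoundOn p (s + 1)
  obtain ⟨C, hC, herr⟩ := ho.exists_local_error_bound_conj hc₂
  refine ⟨C, hC, ?_⟩
  intro d f xs A L M hL hM hmin hgr hdiff vc xc tc htc hA yc E h hyc hE hh hhle
  have hκ := rk.kappa_nonneg
  have htc0 : 0 < tc := by linarith
  have hgap : tc ^ p * (f xc - f xs) ≤ E := by
    have := gap_le_lyapunov (p := p) (f := f) (xs := xs) yc
    rw [← hE] at this
    rwa [hyc] at this
  have hE0 : 0 ≤ E := (mul_nonneg (by positivity) (sub_nonneg.2 (hmin _))).trans hgap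
  set K : ℝ := (E + 1) * (L + M + 1) with hKdef
  have hK1 : 1 ≤ K := one_le_mul_of_one_le_of_one_le (by linarith) (by linarith)
  have hK0 : 0 < K := by linarith
  have hLE : L * E ≤ K := by
    have := mul_nonneg hE0 hM
    rw [hKdef]; nlinarith
  have hMK : M ≤ K := by
    have := mul_nonneg hE0 (by linarith : 0 ≤ L + M + 1)
    rw [hKdef]; nlinarith
  have hEK : E ≤ K := by
    have := mul_nonneg hE0 (by linarith : 0 ≤ L + M)
    rw [hKdef]; nlinarith
  have hv₀ : ‖tc • vc‖ ≤ 2 * p * K := by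
    have h1 : ‖tc • vc‖ ^ 2 ≤ 4 * (p : ℝ) ^ 2 * E := by
      have := norm_velocity_sq_le_lyapunov hp hmin (y := yc) (by rw [hyc]; exact htc0.le)
      rw [← hE] at this
      rwa [hyc] at this
    refine le_of_sq_le_sq (h1.trans ?_) (by positivity)
    rw [mul_pow, mul_pow]
    have h2 : E ≤ K ^ 2 := hEK.trans (le_self_pow₀ hK1 two_ne_zero)
    have h3 := mul_le_mul_of_nonneg_left h2 (by positivity : 0 ≤ 4 * (p : ℝ) ^ 2)
    linarith
  have hf1 : ContDiff ℝ (s + 2 : ℕ) f :=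
    hdiff.1.of_le (by exact_mod_cast le_max_right _ _)
  have hfd : Differentiable ℝ f := hf1.differentiable (by simp)
  have hφ1 : ContDiff ℝ (s + 2 : ℕ) fun ξ => tc ^ p * f (xc + tc⁻¹ • ξ) :=
    contDiff_const.mul (hf1.comp (contDiff_const.add (contDiff_const_smul _)))
  have hgrad : DerivBoundOn (s + 1) (p + 5)
      (fun ξ => K⁻¹ • gradient (fun ξ => tc ^ p * f (xc + tc⁻¹ • ξ)) ξ)
      (Metric.ball 0 (1 / 2)) := by
    have h1 := (derivBoundOn_gradient Metric.isOpen_ball hφ1 fun i hi his ξ hξ =>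
      norm_iteratedFDeriv_scaled_le_of_growth hL htc hgr hdiff hA hgap hLE hK1 hMK hi his
        hξ).const_smul Metric.isOpen_ball.uniqueDiffOn K⁻¹
    refine h1.mono (le_of_eq ?_)
    rw [abs_of_pos (inv_pos.2 hK0)]
    field_simp
  set g := scaledField p tc K (tc • vc) (fun ξ => tc ^ p * f (xc + tc⁻¹ • ξ)) with hg
  have hgb : DerivBoundOn (s + 1) c₂ g (Metric.ball 0 (1 / 2)) :=
    hfield d tc K (tc • vc) _ htc hK1 hv₀ hgrad
  have hgc : ∀ z ∈ Metric.ball (0 : State d) (1 / 2), ‖g z‖ < c₁ + 1 := fun z hz =>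
    ((hfield₀ d tc K (tc • vc) _ htc hK1 hv₀ (hgrad.of_le (Nat.zero_le _))).norm_le hz).trans_lt
      (lt_add_one _)
  have hconj : ∀ z, field p f (yc + rescale d htc0.ne' z) = K • rescale d htc0.ne' (g z) := by
    rw [hyc]
    exact field_conj hp hfd htc0.ne' hK0.ne' vc xc
  have hKh0 : 0 < K * h := mul_pos hK0 hh
  have hKh : K * h * (1 + rk.kappa) * (4 * (c₁ + 1)) ≤ 1 := by
    have h1 := hhle.trans (min_le_right _ _)
    rw [le_div_iff₀ (by positivity)] at h1
    refine le_trans (le_of_eq ?_) h1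
    rw [hKdef]; ring
  have hKhκ : 0 ≤ K * h * rk.kappa := by positivity
  have hKh2 : K * h * (1 + rk.kappa) * (c₁ + 1) < 1 / 2 := by linarith
  have hKhc : K * h * (c₁ + 1) < 1 / 2 := by
    have := mul_nonneg hKhκ (by linarith : 0 ≤ c₁ + 1)
    nlinarith
  have hKh1 : K * h ≤ 1 := by
    have := mul_nonneg hKh0.le hc₁
    nlinarith
  refine ⟨?_, fun φ hφ => ?_⟩
  · obtain ⟨ψ, hψ⟩ := exists_isSolutionOn hKh0 (by linarith) hgb hgc hKhc
    exact ⟨_, hψ.of_conj hconj hK0⟩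
  · obtain ⟨z, e, hb⟩ := herr (State d) _ g yc (rescale d htc0.ne') K (1 / 2) (c₁ + 1) h φ hconj
      hK0 hh hKh1 (by linarith) hgb hgc hKh2 hφ
    -- Both endpoints have time t_c + h, so the error has no time component.
    have ht : time (rescale d htc0.ne' z) = 0 := by
      rw [← e]
      change time (rk.step (field p f) h yc) - time (φ h) = 0
      rw [time_step_field (ho.sum_b_eq_one hs), hφ.time_eq hh.le, sub_self]
    rw [e, norm_rescale_of_time_eq_zero htc0 ht]
    have hrest : 0 ≤ h * (1 + E) ^ (s + 2) * (L + M + 1) ^ (s + 2) := by positivity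
    calc tc⁻¹ * ‖z‖ ≤ tc⁻¹ * (C * (K * h) ^ (s + 1)) := by gcongr
      _ = h ^ (s + 1) * (C * ((1 + E) ^ (s + 1) * (L + M + 1) ^ (s + 1)) / tc) := by
        rw [hKdef, add_comm E 1, mul_pow, mul_pow]
        field_simp
      -- The first term of the bracket already suffices; the second is nonnegative.
      _ ≤ _ := by
        gcongr
        linarith
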